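/- Let $k$ be a finite extension of some $\mathbb{Q}_p$ (equivalently, a non-archimedean local field of characteristic $0$), with ring of integers $\mathcal{O}_k$ and maximal ideal $\mathfrak{m}_k$. Let $M=\mathrm{Frac}\,\mathcal{O}_k[[T]]$ and let $L=k\{\{T\}\}$ be the completion of $M$ for the discrete valuation given by the height one prime $\mathfrak{m}_k\mathcal{O}_k[[T]]$. Every $f\in M^\times$ is uniquely $f=f_0\frac{a_f}{b_f}u_f$ with $f_0\in k^\times$, $a_f,b_f\in\mathcal{O}_k[T]$ relatively prime distinguished polynomials and $u_f\in 1+T\mathcal{O}_k[[T]]$; put $w(f)=\deg a_f-\deg b_f$. Let $V(p)$ be the multiset of roots of $p$ in an algebraic closure of $k$, and for $f,g\in M^\times$ define $$\{f,g\}_M=(-1)^{w(f)w(g)}\frac{g_0^{w(f)}}{f_0^{w(g)}}\cdot\frac{\prod_{\alpha\in V(a_f)}u_g(\alpha)}{\prod_{\alpha\in V(a_g)}u_f(\alpha)}\cdot\frac{\prod_{\beta\in V(b_g)}u_f(\beta)}{\prod_{\beta\in V(b_f)}u_g(\beta)}\in k^\times .$$ Let $K_2$ be Milnor's $K_2$.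 For a discrete valuation field $F$ and $i\ge 1$ let $U^i_F=\{x : x-1\in\mathfrak{m}_F^i\}$, let $U^iK_2(F)$ be the subgroup of $K_2(F)$ generated by the symbols $\{u,x\}$ and $\{x,u\}$ with $u\in U^i_F$, $x\in F^\times$, and let $\widehat{K}_2(F)=\varprojlim_i K_2(F)/U^iK_2(F)$. Then there is exactly one homomorphism $\widehat\partial_L:\widehat{K}_2(L)\to k^\times$ that sends the class of $\{f,g\}$ to $\{f,g\}_M$ for all $f,g\in M^\times$ and that, for every $i\ge1$, sends the kernel of $\widehat{K}_2(L)\to K_2(L)/U^iK_2(L)$ into $U^i_k$. For $f,g\in L^\times$ let $\{f,g\}_L\in k^\times$ be the image under $\widehat\partial_L$ of the class of $\{f,g\}$. Suppose that $f,g\in L^\times$ have winding numbers $w(f),w(g)\in\mathbb{Z}$ and Witt parameters $(f_i)_{i\in\mathbb{Z}}$, $(g_i)_{i\in\mathbb{Z}}$, that is, $$f=f_0T^{w(f)}\prod_{i\ge1}(1-f_{-i}T^{-i})(1-f_iT^i)$$ with $f_0\in k^\times$, and $f_i\in\mathcal{O}_k$, $f_{-i}\in\mathfrak{m}_k$ for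 $i\ge1$, and $\lim_{i\to\infty}f_{-i}=0$, and likewise for $g$. (Here $\prod_{i\ge1}(1-f_iT^i)$ converges coefficientwise in $\mathcal{O}_k[[T]]$ and $\prod_{i\ge1}(1-f_{-i}T^{-i})$ converges in $L$.) Then, with $(i,j)$ the greatest common divisor of $i$ and $j$, the product below converges (unconditionally) and $$\{f,g\}_L=(-1)^{w(f)w(g)}\frac{g_0^{w(f)}}{f_0^{w(g)}}\prod_{i,j\ge1}\frac{\bigl(1-f_{-i}^{j/(i,j)}g_j^{i/(i,j)}\bigr)^{(i,j)}}{\bigl(1-f_i^{j/(i,j)}g_{-j}^{i/(i,j)}\bigr)^{(i,j)}} .$$ -/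

import Mathlib

open scoped NNReal PowerSeries TensorProduct Topology

noncomputable section
namespace KatoSymbol

section Coefficients
variable (k : Type*) [NontriviallyNormedField k] [IsUltrametricDist k]

/-- The ring of integers `𝒪_k = {x : ‖x‖ ≤ 1}` of `k`. -/
abbrev IntegerRing : ValuationSubring k := (NormedField.valuation (K := k)).valuationSubring

/-- The ring `A = 𝒪_k[[T]]`. -/
abbrev PowerRing : Type _ := PowerSeries (IntegerRing k)

theorem isDiscreteValuationRing_IntegerRing [ProperSpace k] : IsDiscreteValuationRing (IntegerRing k) := by
  let _ : Valued k ℝ≥0 := NormedField.toValued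
  have hc : CompactSpace (Valued.integer k) := by
    refine isCompact_iff_compactSpace (s := ((Valued.integer k : Subring k) : Set k)).mp ?_
    have : ((Valued.integer k : Subring k) : Set k) = Metric.closedBall 0 1 := by
      ext x
      simp only [SetLike.mem_coe, mem_closedBall_zero_iff]
      exact Valued.integer.mem_iff
    rw [this]
    exact isCompact_closedBall 0 1
  have hn : (Valued.v : Valuation k ℝ≥0).IsNontrivial := by
    obtain ⟨x, hx⟩ := NormedField.exists_one_lt_norm k
    refine ⟨x, ?_, ?_⟩
    · change ‖x‖₊ ≠ 0
      intro h
      have : ‖x‖ = 0 := by simpa using congrArg NNReal.toReal h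
      linarith
    · change ‖x‖₊ ≠ 1
      intro h
      have : ‖x‖ = 1 := by simpa using congrArg NNReal.toReal h
      linarith
  exact Valued.integer.isDiscreteValuationRing_of_compactSpace (K := k)

variable {k}

/-- The Gauss norm `sup_n ‖a_n‖` of `∑ a_n T^n`; additively this is `inf_n ν(a_n)`. -/
def gauss (f : PowerRing k) : ℝ≥0 := ⨆ n, ‖(f.coeff n : k)‖₊

theorem coeff_le_gauss (f : PowerRing k) (n : ℕ) : ‖(f.coeff n : k)‖₊ ≤ gauss f :=
  le_ciSup (f := fun n => ‖(f.coeff n : k)‖₊)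
    ⟨1, by rintro _ ⟨m, rfl⟩; exact (f.coeff m).2⟩ n

theorem exists_coeff_eq_gauss [ProperSpace k] (f : PowerRing k) :
    ∃ n, ‖(f.coeff n : k)‖₊ = gauss f := by
  have := isDiscreteValuationRing_IntegerRing k
  obtain ⟨I, ⟨n, rfl⟩, hI⟩ := set_has_maximal_iff_noetherian.mpr
    (inferInstance : IsNoetherian (IntegerRing k) (IntegerRing k))
    (Set.range fun n => Ideal.span {f.coeff n}) ⟨_, 0, rfl⟩
  refine ⟨n, le_antisymm (coeff_le_gauss f n) (ciSup_le fun m => ?_)⟩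
  by_contra! h
  refine hI _ ⟨m, rfl⟩ ?_
  dsimp only
  generalize f.coeff n = a at *
  generalize f.coeff m = b at *
  have hb : (b : k) ≠ 0 := by
    intro h0
    rw [h0] at h
    simp at h
  have hab : ‖(a : k) / b‖₊ ≤ 1 := by
    rw [nnnorm_div]
    exact div_le_one_of_le₀ h.le zero_le
  have hdvd : b ∣ a := ⟨⟨_, hab⟩, by ext; simp [mul_div_cancel₀ _ hb]⟩
  refine lt_of_le_of_ne ((Ideal.span_singleton_le_span_singleton).mpr hdvd) fun he => ?_
  obtain ⟨c, hc⟩ := (Ideal.span_singleton_le_span_singleton).mp he.ge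
  have : ‖(b : k)‖₊ ≤ ‖(a : k)‖₊ := by
    rw [hc]
    push_cast
    rw [nnnorm_mul]
    exact mul_le_of_le_one_right zero_le c.2
  exact absurd h this.not_gt

theorem gauss_mul [ProperSpace k] (f g : PowerRing k) : gauss (f * g) = gauss f * gauss g := by
  classical
  apply le_antisymm
  · refine ciSup_le fun n => ?_
    rw [PowerSeries.coeff_mul]
    push_cast
    refine IsUltrametricDist.nnnorm_sum_le_of_forall_le fun p _ => ?_
    rw [nnnorm_mul]
    exact mul_le_mul' (coeff_le_gauss f _) (coeff_le_gauss g _)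
  · by_cases hf : gauss f = 0
    · simp [hf]
    by_cases hg : gauss g = 0
    · simp [hg]
    have h1 := exists_coeff_eq_gauss f
    have h2 := exists_coeff_eq_gauss g
    set i := Nat.find h1 with hi
    set j := Nat.find h2 with hj
    have hi1 : ‖(f.coeff i : k)‖₊ = gauss f := Nat.find_spec h1
    have hj1 : ‖(g.coeff j : k)‖₊ = gauss g := Nat.find_spec h2
    have key : ‖((f * g).coeff (i + j) : k)‖₊ = gauss f * gauss g := by
      rw [PowerSeries.coeff_mul]
      push_cast
      have hlt : ∀ p ∈ Finset.HasAntidiagonal.antidiagonal (i + j), p ≠ (i, j) →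
          ‖(f.coeff p.1 : k) * (g.coeff p.2 : k)‖₊ < ‖(f.coeff i : k) * (g.coeff j : k)‖₊ := by
        intro p hp hne
        rw [nnnorm_mul, nnnorm_mul, hi1, hj1]
        have hs : p.1 + p.2 = i + j := by simpa using hp
        rcases lt_or_ge p.1 i with h | h
        · exact (mul_le_mul_of_nonneg_left (coeff_le_gauss g _) zero_le).trans_lt
            (mul_lt_mul_of_pos_right (lt_of_le_of_ne (coeff_le_gauss f _) (Nat.find_min h1 h))
              (pos_iff_ne_zero.mpr hg))
        · have h' : p.2 < j := by
            by_contra! h'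
            exact hne (Prod.ext (by dsimp; omega) (by dsimp; omega))
          exact (mul_le_mul_of_nonneg_right (coeff_le_gauss f _) zero_le).trans_lt
            (mul_lt_mul_of_pos_left (lt_of_le_of_ne (coeff_le_gauss g _) (Nat.find_min h2 h'))
              (pos_iff_ne_zero.mpr hf))
      have hsum := IsNonarchimedean.apply_sum_eq_of_lt
        (IsUltrametricDist.isNonarchimedean_norm (R := k)) (fun a => (norm_neg a).symm)
        (s := Finset.HasAntidiagonal.antidiagonal (i + j))
        (l := fun p : ℕ × ℕ => (f.coeff p.1 : k) * (g.coeff p.2 : k))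
        (k := (i, j)) (by simp) hlt
      rw [← hi1, ← hj1, ← nnnorm_mul]
      exact NNReal.eq hsum
    rw [← key]
    exact coeff_le_gauss _ _

variable (k) in
/-- The valuation of `𝒪_k[[T]]` attached to the height one prime `𝔪_k 𝒪_k[[T]]`, written
multiplicatively and normalised to extend the norm of `k`. -/
def gaussValuation [ProperSpace k] : Valuation (PowerRing k) ℝ≥0 where
  toFun := gauss
  map_zero' := by simp [gauss]
  map_one' := by
    apply le_antisymm
    · exact ciSup_le fun n => (PowerSeries.coeff n (1 : PowerRing k)).2
    · simpa using coeff_le_gauss (1 : PowerRing k) 0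
  map_mul' := gauss_mul
  map_add_le_max' f g := ciSup_le fun n => by
    have := IsUltrametricDist.isNonarchimedean_nnnorm (R := k) (f.coeff n) (g.coeff n)
    simp only [map_add]
    exact this.trans (max_le_max (coeff_le_gauss f n) (coeff_le_gauss g n))

theorem nonZeroDivisors_le [ProperSpace k] :
    nonZeroDivisors (PowerRing k) ≤ (gaussValuation k).supp.primeCompl := by
  intro f hf h0
  have h0 : gauss f = 0 := h0
  refine nonZeroDivisors.ne_zero hf (PowerSeries.ext fun n => ?_)
  have := coeff_le_gauss f n
  rw [h0] at this
  simpa using this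


variable (k)

/-- The field `M = Frac 𝒪_k[[T]]`. -/
abbrev FracField : Type _ := FractionRing (PowerRing k)

/-- The inclusion `𝒪_k[[T]] → M`. -/
def powerToM : PowerRing k →+* FracField k := algebraMap _ _

/-- The inclusion of constants `k → M`. -/
def constToM : k →+* FracField k :=
  IsFractionRing.lift (A := IntegerRing k) (g := (powerToM k).comp PowerSeries.C)
    ((IsFractionRing.injective (PowerRing k) (FracField k)).comp PowerSeries.C_injective)

variable [ProperSpace k]

/-- The discrete valuation of `M` attached to the height one prime `𝔪_k 𝒪_k[[T]]`. -/
def valM : Valuation (FracField k) ℝ≥0 :=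
  (gaussValuation k).extendToLocalization nonZeroDivisors_le (FracField k)

/-- The standard field `L = k{{T}}`: the completion of `M` with respect to `valM k`. -/
abbrev StdField : Type _ := (valM k).Completion

/-- The valuation of `L`, extending that of `M` by continuity. -/
def valL : Valuation (StdField k) ℝ≥0 := Valued.v

/-- The canonical embedding `M → L`. -/
def mToL : FracField k →+* StdField k :=
  UniformSpace.Completion.coeRingHom.comp (WithVal.equiv (valM k)).symm.toRingHom

end Coefficients

section Milnor

variable (F : Type*) [Field F]

/-- The Steinberg relations: the subgroup of `Fˣ ⊗ Fˣ` generated by `a ⊗ b` with `a + b = 1`. -/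
def steinbergRelations : AddSubgroup (Additive Fˣ ⊗[ℤ] Additive Fˣ) :=
  AddSubgroup.closure
    {t | ∃ a b : Fˣ, (a : F) + (b : F) = 1 ∧ t = Additive.ofMul a ⊗ₜ[ℤ] Additive.ofMul b}

/-- The Milnor `K`-group `K₂(F)`, written additively. -/
abbrev MilnorK2 : Type _ := (Additive Fˣ ⊗[ℤ] Additive Fˣ) ⧸ steinbergRelations F

variable {F}

/-- The class `{a, b}` in `K₂(F)`. -/
def milnorSymbol (a b : Fˣ) : MilnorK2 F :=
  QuotientAddGroup.mk (Additive.ofMul a ⊗ₜ[ℤ] Additive.ofMul b)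

variable {Γ : Type*} [LinearOrderedCommGroupWithZero Γ] (v : Valuation F Γ)

/-- `U^i = {u : u - 1 ∈ 𝔪^i}`, where `𝔪` is the maximal ideal of the valuation ring of `v`.
It is used for discrete valuations and `i ≥ 1` only. -/
def higherUnits (i : ℕ+) : Set Fˣ :=
  {u | ∃ x ∈ IsLocalRing.maximalIdeal v.valuationSubring ^ (i : ℕ), (x : F) = (u : F) - 1}

/-- `U^i K₂(F)`: the degree two part of the graded ideal of the Milnor ring generated by
`U^i ⊆ K₁(F)`. -/
def filtrationK2 (i : ℕ+) : AddSubgroup (MilnorK2 F) :=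
  AddSubgroup.closure
    {t | ∃ u ∈ higherUnits v i, ∃ x : Fˣ, t = milnorSymbol u x ∨ t = milnorSymbol x u}

theorem filtrationK2_antitone {i j : ℕ+} (h : i ≤ j) : filtrationK2 v j ≤ filtrationK2 v i := by
  refine AddSubgroup.closure_mono ?_
  rintro t ⟨u, ⟨y, hy, hyu⟩, x, ht⟩
  exact ⟨u, ⟨y, Ideal.pow_le_pow_right (PNat.coe_le_coe i j |>.mpr h) hy, hyu⟩, x, ht⟩

/-- The transition map `K₂(F)/U^j K₂(F) → K₂(F)/U^i K₂(F)` for `i ≤ j`. -/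
def transitionK2 {i j : ℕ+} (h : i ≤ j) :
    MilnorK2 F ⧸ filtrationK2 v j →+ MilnorK2 F ⧸ filtrationK2 v i :=
  QuotientAddGroup.map _ _ (AddMonoidHom.id _) (filtrationK2_antitone v h)

/-- The completed group: the inverse limit of the groups `K₂(F)/U^i K₂(F)`, `i ≥ 1`. -/
def CompletedK2 : AddSubgroup (∀ i : ℕ+, MilnorK2 F ⧸ filtrationK2 v i) where
  carrier := {x | ∀ i j : ℕ+, ∀ h : i ≤ j, transitionK2 v h (x j) = x i}
  zero_mem' := fun _ _ _ => map_zero _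
  add_mem' := fun {x y} hx hy i j h => by simp [hx i j h, hy i j h]
  neg_mem' := fun {x} hx i j h => by simp [hx i j h]

/-- The canonical map from `K₂(F)` to its completion. -/
def toCompletedK2 : MilnorK2 F →+ CompletedK2 v where
  toFun x := ⟨fun _ => QuotientAddGroup.mk x, fun _ _ _ => rfl⟩
  map_zero' := rfl
  map_add' _ _ := rfl

end Milnor

section SymbolM

variable (k : Type*) [NontriviallyNormedField k] [IsUltrametricDist k]

/-- The data `(f₀, a, b, u)` of a Weierstrass factorisation `f₀ · (a / b) · u`: `f₀ ∈ kˣ`,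
`a, b` relatively prime distinguished polynomials over `𝒪_k`, and `u ∈ 1 + T 𝒪_k[[T]]`. -/
structure WeierstrassData where
  const : kˣ
  num : Polynomial (IntegerRing k)
  den : Polynomial (IntegerRing k)
  unit : PowerRing k
  num_distinguished : num.IsDistinguishedAt (IsLocalRing.maximalIdeal (IntegerRing k))
  den_distinguished : den.IsDistinguishedAt (IsLocalRing.maximalIdeal (IntegerRing k))
  relPrime : IsRelPrime num den
  unit_const : PowerSeries.constantCoeff unit = 1

variable {k}

/-- `f = f₀ · (a / b) · u` in `M`. -/
def WeierstrassData.Represents (D : WeierstrassData k) (f : FracField k) : Prop :=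
  f = constToM k D.const *
    (powerToM k (D.num : PowerRing k) / powerToM k (D.den : PowerRing k)) * powerToM k D.unit

/-- The winding number `deg a - deg b`. -/
def WeierstrassData.winding (D : WeierstrassData k) : ℤ :=
  (D.num.natDegree : ℤ) - (D.den.natDegree : ℤ)

/-- `V(p)`: the roots of `p` in the algebraic closure of `k`, with multiplicities. -/
def rootsInClosure (p : Polynomial (IntegerRing k)) : Multiset (AlgebraicClosure k) :=
  (p.map ((algebraMap k (AlgebraicClosure k)).comp (IntegerRing k).subtype)).roots

variable [ProperSpace k]

/-- The value `u(α)` of `u ∈ 𝒪_k[[T]]` at `α` in the algebraic closure of `k`, as the sum of a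
series for the topology given by the unique extension of the norm of `k`. It is used for
`‖α‖ < 1` only, where the series converges. -/
def evalInClosure (u : PowerRing k) (α : AlgebraicClosure k) : AlgebraicClosure k :=
  letI : MetricSpace (AlgebraicClosure k) := spectralNorm.metricSpace k (AlgebraicClosure k)
  ∑' n : ℕ, algebraMap k (AlgebraicClosure k) (u.coeff n) * α ^ n

/-- `∏_{α ∈ V(p)} u(α)`. -/
def prodOverRoots (u : PowerRing k) (p : Polynomial (IntegerRing k)) : AlgebraicClosure k :=
  ((rootsInClosure p).map (evalInClosure u)).prod

/-- The expression defining `{f, g}_M` in terms of Weierstrass factorisations of `f` and `g`. -/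
def weierstrassSymbol (D E : WeierstrassData k) : AlgebraicClosure k :=
  (-1) ^ (D.winding * E.winding) *
    (algebraMap k (AlgebraicClosure k) E.const ^ D.winding /
      algebraMap k (AlgebraicClosure k) D.const ^ E.winding) *
    (prodOverRoots E.unit D.num / prodOverRoots D.unit E.num) *
    (prodOverRoots D.unit E.den / prodOverRoots E.unit D.den)

/-- `z ∈ kˣ` is the value `{f, g}_M` (the Weierstrass factorisations of `f` and `g` exist
and are unique). -/
def IsSymbolM (f g : (FracField k)ˣ) (z : kˣ) : Prop :=
  ∃ D E : WeierstrassData k, D.Represents f ∧ E.Represents g ∧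
    algebraMap k (AlgebraicClosure k) z = weierstrassSymbol D E

end SymbolM

section SymbolL

variable {k : Type*} [NontriviallyNormedField k] [IsUltrametricDist k] [ProperSpace k]

/-- The class in the completed `K₂(L)` of a symbol `{f, g}` with `f, g ∈ Lˣ`. -/
def completedSymbol (f g : (StdField k)ˣ) : CompletedK2 (valL k) :=
  toCompletedK2 (valL k) (milnorSymbol f g)

/-- `∂` is the homomorphism from the completed `K₂(L)` to `K₁(k) = kˣ` induced by `{,}_M`: it
sends the image of `{f, g}`, `f, g ∈ Mˣ`, to `{f, g}_M`, and for every `i ≥ 1` it induces a map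
`K₂(L)/U^i K₂(L) → kˣ/U^i` (which is thus the one that `{,}_M` induces through
`K₂(M)/U^i K₂(M) ≅ K₂(L)/U^i K₂(L)`). -/
structure IsInducedBoundary (d : CompletedK2 (valL k) →+ Additive kˣ) : Prop where
  extends_symbolM : ∀ f g : (FracField k)ˣ,
    IsSymbolM f g (d (completedSymbol (Units.map (mToL k) f) (Units.map (mToL k) g))).toMul
  filtered : ∀ (i : ℕ+) (x : CompletedK2 (valL k)), x.1 i = 0 →
    (d x).toMul ∈ higherUnits (NormedField.valuation (K := k)) i

variable (k) in
/-- The induced homomorphism from the completed `K₂(L)` to `K₁(k) = kˣ`. -/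
def boundaryL : CompletedK2 (valL k) →+ Additive kˣ :=
  Classical.epsilon IsInducedBoundary

/-- The symbol `{f, g}_L ∈ kˣ`. -/
def symbolL (f g : (StdField k)ˣ) : kˣ := (boundaryL k (completedSymbol f g)).toMul

end SymbolL

section Witt

variable (k : Type*) [NontriviallyNormedField k] [IsUltrametricDist k]

/-- A winding number `w` and Witt parameters: `zero` is `f₀`, `pos i` is `f_i` and `neg i` is
`f_{-i}`, for `i ≥ 1`. -/
structure WittData where
  w : ℤ
  zero : kˣ
  pos : ℕ+ → IntegerRing k
  neg : ℕ+ → IntegerRing k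
  neg_mem : ∀ i, neg i ∈ IsLocalRing.maximalIdeal (IntegerRing k)
  neg_tendsto : Filter.Tendsto (fun i => (neg i : k)) Filter.atTop (𝓝 0)

variable {k} [ProperSpace k]

/-- The element `T` of `L`. -/
def paramT : StdField k := mToL k (powerToM k PowerSeries.X)

open scoped PowerSeries.WithPiTopology in
/-- `f = f₀ T^w ∏_{i ≥ 1} (1 - f_{-i} T^{-i}) (1 - f_i T^i)` in `L`. The product of the factors
`1 - f_i T^i` converges coefficientwise, in `𝒪_k[[T]]`; the product of the factors
`1 - f_{-i} T^{-i}` converges in the valuation topology of `L`. -/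
def WittData.Represents (D : WittData k) (f : StdField k) : Prop :=
  ∃ (P : PowerRing k) (N : StdField k),
    HasProd (fun i : ℕ+ => (1 - PowerSeries.C (D.pos i) * PowerSeries.X ^ (i : ℕ) : PowerRing k)) P ∧
    HasProd (fun i : ℕ+ => 1 - mToL k (constToM k (D.neg i)) * paramT ^ (-(i : ℤ))) N ∧
    f = mToL k (constToM k D.zero) * paramT ^ D.w * N * mToL k (powerToM k P)

end Witt

end KatoSymbol

end

set_option linter.unusedSectionVars false

noncomputable section
namespace KatoSymbol

/-! ### The ring of integers: divisibility and completeness through the norm -/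

section IntegerRing
variable {k : Type*} [NontriviallyNormedField k] [IsUltrametricDist k]

/-! Everything rests on one reformulation. For a distinguished polynomial `a` and a power series
`u`, the product of the values of `u` at the roots of `a` is the resultant of `a` with the remainder
of `u` in Weierstrass division by `a` (`intToClosure_normRoot`). Hence it lies in 𝒪_k, is
multiplicative in `a` and in `u`, and depends only on `u` modulo `a`. By Weierstrass preparation Mˣ
is the group of fractions of the monoid of triples (constant, distinguished polynomial, one-unit)
(`isGroupCompletion_tripleToM`), so a bimultiplicative formula on triples extends to the symbol
`symM` on Mˣ.

Two properties carry this symbol to the completed K₂ of L. The Steinberg relation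
(`symM_steinberg`): for f = x/z and 1 - f = (z - x)/z, the congruences among x, z and z - x modulo
one another make the products over roots cancel, with signs supplied by the symmetry of resultants.
Continuity (`symM_mem_unitFil`): series congruent modulo π^i and nonzero in the residue field have
Weierstrass factors congruent modulo π^i (`weierstrass_congr`), and resultants are polynomials in
the coefficients (`normRoot_congr`).

Since M is dense in L, every element of Lˣ agrees with one of Mˣ up to U^i, which gives symbols Lˣ ×
Lˣ → kˣ/U^i (`symLMod`). As kˣ is complete and separated for the U^i, their limit is the boundary
map. A filtered homomorphism is determined modulo each U^i by its values on symbols from M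
(`IsSymbolSystem.unitsMk_apply`); this is uniqueness.

For the formula, work modulo a fixed U^e. Truncating the products in negative powers of T replaces f
and g by elements of M with numerators built from T and T^i - f_{-i}, and denominators powers of T;
the powers of T contribute no root values because one-units take the value 1 at 0. There remain the
values of the one-units at the roots of T^i - c. For the factor 1 - g T^j these multiply, by a
computation with roots of unity, to the stated factor (`normRoot_one_sub`), and T^{ie} ≡ c^e modulo
T^i - c makes only j < ie matter. All but finitely many factors lie in U^e, whence also
unconditional convergence (`hasProd_symbolFactor`). -/

theorem integer_norm_le (x : IntegerRing k) : ‖(x : k)‖ ≤ 1 := x.2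

theorem mem_integerRing {x : k} : x ∈ IntegerRing k ↔ ‖x‖ ≤ 1 := Iff.rfl

theorem integer_dvd_iff {x y : IntegerRing k} (hx : x ≠ 0) : x ∣ y ↔ ‖(y : k)‖ ≤ ‖(x : k)‖ := by
  have hx' : (x : k) ≠ 0 := by simpa using hx
  constructor
  · rintro ⟨z, rfl⟩
    simpa using mul_le_of_le_one_right (norm_nonneg (x : k)) (integer_norm_le z)
  · intro h
    refine ⟨⟨(y : k) / x, mem_integerRing.2 ?_⟩, ?_⟩
    · rw [norm_div]
      exact div_le_one_of_le₀ h (norm_nonneg _)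
    · ext
      simp [mul_div_cancel₀ _ hx']

theorem integer_isUnit_iff {x : IntegerRing k} : IsUnit x ↔ ‖(x : k)‖ = 1 := by
  rw [isUnit_iff_dvd_one]
  by_cases hx : x = 0
  · simp [hx]
  rw [integer_dvd_iff hx]
  simpa using ⟨fun h => le_antisymm (integer_norm_le x) h, fun h => h.ge⟩

theorem mem_maximalIdeal_iff {x : IntegerRing k} :
    x ∈ IsLocalRing.maximalIdeal (IntegerRing k) ↔ ‖(x : k)‖ < 1 := by
  rw [IsLocalRing.mem_maximalIdeal, mem_nonunits_iff, integer_isUnit_iff]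
  exact ⟨fun h => lt_of_le_of_ne (integer_norm_le x) h, fun h => h.ne⟩

variable [ProperSpace k]

instance : IsDiscreteValuationRing (IntegerRing k) := isDiscreteValuationRing_IntegerRing k

variable (k) in
theorem exists_irreducible_integer : ∃ x : IntegerRing k, Irreducible x :=
  IsDiscreteValuationRing.exists_irreducible _

variable (k) in
/-- A chosen uniformizer of `𝒪_k`. -/
def unif : IntegerRing k := Classical.choose (exists_irreducible_integer k)

theorem unif_irreducible : Irreducible (unif k) := Classical.choose_spec (exists_irreducible_integer k)

theorem unif_ne_zero : unif k ≠ 0 := unif_irreducible.ne_zero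

theorem unif_coe_ne_zero : (unif k : k) ≠ 0 := by
  simpa using unif_ne_zero (k := k)

theorem maximalIdeal_eq_span : IsLocalRing.maximalIdeal (IntegerRing k) = Ideal.span {unif k} :=
  (IsDiscreteValuationRing.irreducible_iff_uniformizer _).1 unif_irreducible

theorem norm_unif_lt_one : ‖(unif k : k)‖ < 1 := by
  rw [← mem_maximalIdeal_iff, maximalIdeal_eq_span]
  exact Ideal.mem_span_singleton_self _

theorem norm_unif_pos : 0 < ‖(unif k : k)‖ := norm_pos_iff.2 unif_coe_ne_zero

theorem norm_le_unif {x : k} (hx : ‖x‖ < 1) : ‖x‖ ≤ ‖(unif k : k)‖ := by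
  have : (⟨x, hx.le⟩ : IntegerRing k) ∈ IsLocalRing.maximalIdeal (IntegerRing k) :=
    mem_maximalIdeal_iff.2 hx
  rw [maximalIdeal_eq_span, Ideal.mem_span_singleton, integer_dvd_iff unif_ne_zero] at this
  exact this

theorem unif_pow_dvd_iff {x : IntegerRing k} {n : ℕ} :
    unif k ^ n ∣ x ↔ ‖(x : k)‖ ≤ ‖(unif k : k)‖ ^ n := by
  rw [integer_dvd_iff (pow_ne_zero _ unif_ne_zero)]
  simp

theorem mem_maximalIdeal_pow_iff {x : IntegerRing k} {n : ℕ} :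
    x ∈ IsLocalRing.maximalIdeal (IntegerRing k) ^ n ↔ ‖(x : k)‖ ≤ ‖(unif k : k)‖ ^ n := by
  rw [maximalIdeal_eq_span, Ideal.span_singleton_pow, Ideal.mem_span_singleton, unif_pow_dvd_iff]

/-- Powers of the maximal ideal are closed norm balls, so an adically compatible sequence is Cauchy
in the complete field k. Weierstrass division and preparation over 𝒪_k need this. -/
instance : IsAdicComplete (IsLocalRing.maximalIdeal (IntegerRing k)) (IntegerRing k) where
  prec' f hf := by
    have hd : ∀ {m n}, m ≤ n → ‖(f n : k) - f m‖ ≤ ‖(unif k : k)‖ ^ m := by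
      intro m n hmn
      have := (hf hmn).symm
      rw [SModEq.sub_mem, smul_eq_mul, Ideal.mul_top, mem_maximalIdeal_pow_iff] at this
      simpa using this
    have hc : CauchySeq fun n => (f n : k) := by
      rw [Metric.cauchySeq_iff']
      intro ε hε
      obtain ⟨N, hN⟩ := exists_pow_lt_of_lt_one hε (norm_unif_lt_one (k := k))
      exact ⟨N, fun n hn => by rw [dist_eq_norm]; exact (hd hn).trans_lt hN⟩
    obtain ⟨l, hl⟩ := cauchySeq_tendsto_of_complete hc
    have hl1 : ‖l‖ ≤ 1 := le_of_tendsto hl.norm (Filter.Eventually.of_forall fun n => integer_norm_le _)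
    refine ⟨⟨l, hl1⟩, fun n => ?_⟩
    refine SModEq.symm ?_
    rw [SModEq.sub_mem, smul_eq_mul, Ideal.mul_top, mem_maximalIdeal_pow_iff]
    refine le_of_tendsto (hl.sub_const (f n : k)).norm ?_
    filter_upwards [Filter.eventually_ge_atTop n] with m hm using hd hm

end IntegerRing

/-! ### Higher unit groups as balls around 1 -/

section HigherUnits
variable {F Γ : Type*} [Field F] [LinearOrderedCommGroupWithZero Γ] (v : Valuation F Γ)

theorem valuation_sub_one_mul_le {γ : Γ} (hγ : γ ≤ 1) {x y : F} (hx : v (x - 1) ≤ γ)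
    (hy : v (y - 1) ≤ γ) : v (x * y - 1) ≤ γ := by
  have : x * y - 1 = (x - 1) * (y - 1) + ((x - 1) + (y - 1)) := by ring
  rw [this]
  refine v.map_add_le ?_ (v.map_add_le hx hy)
  rw [map_mul]
  exact (mul_le_mul' hx (hy.trans hγ)).trans_eq (mul_one γ)

theorem valuation_eq_one_of_sub_lt {x : F} (hx : v (x - 1) < 1) : v x = 1 := by
  have := v.map_add_eq_of_lt_right (x := x - 1) (y := 1) (by simpa using hx)
  simpa using this

theorem valuation_inv_sub_one_le {γ : Γ} (hγ : γ < 1) {x : F} (hx : v (x - 1) ≤ γ) :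
    v (x⁻¹ - 1) ≤ γ := by
  have h1 := valuation_eq_one_of_sub_lt v (hx.trans_lt hγ)
  have hx0 : x ≠ 0 := by rintro rfl; simp at h1
  have : x⁻¹ - 1 = -(x⁻¹ * (x - 1)) := by field_simp; ring
  rw [this, Valuation.map_neg, map_mul, map_inv₀, h1]
  simpa using hx

/-- The subgroup `{u : v (u - 1) ≤ γ}` of the unit group, for `γ < 1`. -/
def unitBall (γ : Γ) (hγ : γ < 1) : Subgroup Fˣ where
  carrier := {u | v ((u : F) - 1) ≤ γ}
  one_mem' := by simp
  mul_mem' {x y} hx hy := by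
    simpa using valuation_sub_one_mul_le v hγ.le hx hy
  inv_mem' {x} hx := by
    simpa using valuation_inv_sub_one_le v hγ hx

theorem mem_unitBall {γ : Γ} {hγ : γ < 1} {u : Fˣ} :
    u ∈ unitBall v γ hγ ↔ v ((u : F) - 1) ≤ γ := Iff.rfl

/-- `ϖ` is a uniformizer of the valuation `v`. -/
structure IsUnif (ϖ : F) : Prop where
  ne_zero : ϖ ≠ 0
  lt_one : v ϖ < 1
  le_of_lt : ∀ x, v x < 1 → v x ≤ v ϖ

variable {v}

/-- The inequality amounts to divisibility by the n-th power of the uniformizer, which generates the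
maximal ideal. This turns `higherUnits` into a subgroup defined by an inequality, for k and for L
alike. -/
theorem IsUnif.mem_maximalIdeal_pow {ϖ : F} (h : IsUnif v ϖ) {x : v.valuationSubring} {n : ℕ} :
    x ∈ IsLocalRing.maximalIdeal v.valuationSubring ^ n ↔ v (x : F) ≤ v ϖ ^ n := by
  have hv : v ϖ ≠ 0 := (Valuation.ne_zero_iff _).2 h.ne_zero
  let p : v.valuationSubring := ⟨ϖ, h.lt_one.le⟩
  have hdvd : ∀ (n : ℕ) (y : v.valuationSubring), v (y : F) ≤ v ϖ ^ n ↔ p ^ n ∣ y := by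
    intro n y
    constructor
    · intro hy
      refine ⟨⟨(y : F) / ϖ ^ n, ?_⟩, ?_⟩
      · rw [Valuation.mem_valuationSubring_iff, map_div₀, map_pow]
        exact div_le_one_of_le₀ hy zero_le
      · ext
        simp [p, mul_div_cancel₀ _ (pow_ne_zero n h.ne_zero)]
    · rintro ⟨z, rfl⟩
      have hz : v (z : F) ≤ 1 := z.2
      simpa [p] using mul_le_of_le_one_right' (a := v ϖ ^ n) hz
  have hm : IsLocalRing.maximalIdeal v.valuationSubring = Ideal.span {p} := by
    ext y
    rw [Ideal.mem_span_singleton, ← pow_one p, ← hdvd 1 y, pow_one,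
      ValuationSubring.valuation_lt_one_iff, ← (Valuation.isEquiv_iff_val_lt_one.1
        v.isEquiv_valuation_valuationSubring)]
    exact ⟨h.le_of_lt _, fun hy => hy.trans_lt h.lt_one⟩
  rw [hm, Ideal.span_singleton_pow, Ideal.mem_span_singleton, hdvd]

theorem IsUnif.pow_lt_one {ϖ : F} (h : IsUnif v ϖ) (i : ℕ+) : v ϖ ^ (i : ℕ) < 1 :=
  pow_lt_one₀ zero_le h.lt_one i.ne_zero

theorem IsUnif.mem_higherUnits {ϖ : F} (h : IsUnif v ϖ) {i : ℕ+} {u : Fˣ} :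
    u ∈ higherUnits v i ↔ u ∈ unitBall v (v ϖ ^ (i : ℕ)) (h.pow_lt_one i) := by
  rw [mem_unitBall]
  constructor
  · rintro ⟨x, hx, hxu⟩
    rw [← hxu]
    exact h.mem_maximalIdeal_pow.1 hx
  · intro hu
    exact ⟨⟨(u : F) - 1, hu.trans (h.pow_lt_one i).le⟩, h.mem_maximalIdeal_pow.2 hu, rfl⟩

end HigherUnits

/-! ### The filtration of kˣ by the groups U^i -/

section LocalUnits
variable {k : Type*} [NontriviallyNormedField k] [IsUltrametricDist k] [ProperSpace k]

theorem isUnif_unif : IsUnif (NormedField.valuation (K := k)) (unif k : k) where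
  ne_zero := unif_coe_ne_zero
  lt_one := norm_unif_lt_one
  le_of_lt _ hx := norm_le_unif hx

variable (k) in
/-- The subgroup `U^i` of `kˣ`. -/
def unitFil (i : ℕ+) : Subgroup kˣ :=
  unitBall (NormedField.valuation (K := k)) _ ((isUnif_unif (k := k)).pow_lt_one i)

theorem mem_unitFil {i : ℕ+} {u : kˣ} :
    u ∈ unitFil k i ↔ ‖(u : k) - 1‖ ≤ ‖(unif k : k)‖ ^ (i : ℕ) := Iff.rfl

theorem mem_higherUnits_iff {i : ℕ+} {u : kˣ} :
    u ∈ higherUnits (NormedField.valuation (K := k)) i ↔ u ∈ unitFil k i :=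
  isUnif_unif.mem_higherUnits

end LocalUnits

/-! ### Values of power series at roots of distinguished polynomials, and resultants -/

section Evaluation
open Polynomial

variable {k : Type*} [NontriviallyNormedField k] [IsUltrametricDist k] [ProperSpace k]

/-- Distinguished polynomials over `𝒪_k`. -/
abbrev IsDist (a : (IntegerRing k)[X]) : Prop :=
  a.IsDistinguishedAt (IsLocalRing.maximalIdeal (IntegerRing k))

theorem IsDist.map_residue_ne_zero {a : (IntegerRing k)[X]} (ha : IsDist a) :
    (a : PowerRing k).map (IsLocalRing.residue (IntegerRing k)) ≠ 0 :=
  ha.map_ne_zero_of_eq_mul (a : PowerRing k) 1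
    (by simp) (by simp)

theorem IsDist.order_toNat {a : (IntegerRing k)[X]} (ha : IsDist a) :
    ((a : PowerRing k).map (IsLocalRing.residue (IntegerRing k))).order.toNat = a.natDegree := by
  have := ha.coe_natDegree_eq_order_map (a : PowerRing k) 1 (by simp) (by simp)
  change (a.natDegree : ℕ∞) = ((a : PowerRing k).map (IsLocalRing.residue (IntegerRing k))).order
    at this
  rw [← this]
  simp

theorem IsDist.weierstrassMod_degree_lt {a : (IntegerRing k)[X]} (ha : IsDist a) (u : PowerRing k) :
    (u.weierstrassMod (a : PowerRing k)).degree < a.natDegree := by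
  have := PowerSeries.degree_weierstrassMod_lt u (a : PowerRing k)
  rwa [ha.order_toNat] at this

theorem IsDist.eq_mul_add {a : (IntegerRing k)[X]} (ha : IsDist a) (u : PowerRing k) :
    u = a * u.weierstrassDiv (a : PowerRing k) + (u.weierstrassMod (a : PowerRing k) : PowerRing k) :=
  PowerSeries.eq_mul_weierstrassDiv_add_weierstrassMod u ha.map_residue_ne_zero

/-- The device behind every congruence below: an identity of power series is read as two divisions
of the same series, and quotients and remainders are compared. -/
theorem IsDist.division_unique {a : (IntegerRing k)[X]} (ha : IsDist a) {q q' : PowerRing k}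
    {r r' : (IntegerRing k)[X]} (hr : r.degree < a.natDegree) (hr' : r'.degree < a.natDegree)
    (h : (a : PowerRing k) * q + r = a * q' + r') : q = q' ∧ r = r' := by
  refine PowerSeries.IsWeierstrassDivision.elim (f := (a : PowerRing k) * q + (r : PowerRing k)) ha.map_residue_ne_zero
    ⟨?_, rfl⟩ ⟨?_, h⟩
  · change _ < (((a : PowerRing k).map (IsLocalRing.residue (IntegerRing k))).order.toNat : WithBot ℕ)
    rwa [ha.order_toNat]
  · change _ < (((a : PowerRing k).map (IsLocalRing.residue (IntegerRing k))).order.toNat : WithBot ℕ)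
    rwa [ha.order_toNat]

/-- The algebraic closure of `k` with the unique extension of the norm. -/
instance instNormedFieldAlgebraicClosure : NormedField (AlgebraicClosure k) :=
  spectralNorm.normedField k (AlgebraicClosure k)

theorem norm_algebraMap_closure (x : k) : ‖algebraMap k (AlgebraicClosure k) x‖ = ‖x‖ :=
  spectralNorm_extends x

instance : IsUltrametricDist (AlgebraicClosure k) :=
  IsUltrametricDist.isUltrametricDist_of_isNonarchimedean_norm
    (isNonarchimedean_spectralNorm (K := k) (L := AlgebraicClosure k))

variable (k) in
/-- The inclusion of `𝒪_k` into the algebraic closure of `k`. -/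
def intToClosure : IntegerRing k →+* AlgebraicClosure k :=
  (algebraMap k (AlgebraicClosure k)).comp (IntegerRing k).subtype

theorem intToClosure_apply (x : IntegerRing k) :
    intToClosure k x = algebraMap k (AlgebraicClosure k) x := rfl

theorem intToClosure_injective : Function.Injective (intToClosure k) :=
  (algebraMap k (AlgebraicClosure k)).injective.comp Subtype.val_injective

theorem norm_intToClosure (x : IntegerRing k) : ‖intToClosure k x‖ = ‖(x : k)‖ :=
  norm_algebraMap_closure _

theorem norm_intToClosure_le (x : IntegerRing k) : ‖intToClosure k x‖ ≤ 1 :=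
  (norm_intToClosure x).trans_le (integer_norm_le x)

theorem rootsInClosure_def (p : (IntegerRing k)[X]) :
    rootsInClosure p = (p.map (intToClosure k)).roots := rfl

theorem mem_rootsInClosure {p : (IntegerRing k)[X]} (hp : p ≠ 0) {α : AlgebraicClosure k} :
    α ∈ rootsInClosure p ↔ p.eval₂ (intToClosure k) α = 0 := by
  rw [rootsInClosure_def, mem_roots', IsRoot.def, eval_map]
  exact and_iff_right ((Polynomial.map_ne_zero_iff intToClosure_injective).2 hp)

theorem norm_eval₂_le (r : (IntegerRing k)[X]) {α : AlgebraicClosure k} (hα : ‖α‖ ≤ 1) :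
    ‖r.eval₂ (intToClosure k) α‖ ≤ 1 := by
  rw [eval₂_eq_sum_range]
  refine IsUltrametricDist.norm_sum_le_of_forall_le_of_nonneg zero_le_one fun i _ => ?_
  rw [norm_mul, norm_pow]
  exact mul_le_one₀ (norm_intToClosure_le _) (by positivity) (pow_le_one₀ (norm_nonneg _) hα)

/-- If ‖α‖ ≥ 1, the leading term strictly dominates every other term of a(α), because the lower
coefficients lie in the maximal ideal; the ultrametric inequality then excludes a(α) = 0. -/
theorem IsDist.norm_root_lt_one {a : (IntegerRing k)[X]} (ha : IsDist a) {α : AlgebraicClosure k}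
    (hα : a.eval₂ (intToClosure k) α = 0) : ‖α‖ < 1 := by
  by_contra! h
  have hpos : 0 < ‖α‖ := zero_lt_one.trans_le h
  rw [eval₂_eq_sum_range, Finset.sum_range_succ, ha.monic.coeff_natDegree, map_one, one_mul,
    add_eq_zero_iff_neg_eq] at hα
  have h2 : ‖α‖ ^ a.natDegree = ‖∑ i ∈ Finset.range a.natDegree,
      intToClosure k (a.coeff i) * α ^ i‖ := by rw [← norm_pow, ← hα, norm_neg]
  rcases (Finset.range a.natDegree).eq_empty_or_nonempty with he | hne
  · rw [he] at h2
    simp at h2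
    exact hpos.ne' (by simp [h2.1])
  obtain ⟨i, hi, hle⟩ := IsUltrametricDist.exists_norm_finsetSum_le_of_nonempty hne
    (fun i => intToClosure k (a.coeff i) * α ^ i)
  rw [← h2, norm_mul, norm_pow, norm_intToClosure] at hle
  have hi' := Finset.mem_range.1 hi
  have h3 : ‖(a.coeff i : k)‖ < 1 := mem_maximalIdeal_iff.1 (ha.mem hi')
  have h4 : ‖α‖ ^ i ≤ ‖α‖ ^ a.natDegree := pow_le_pow_right₀ h hi'.le
  have h5 : ‖(a.coeff i : k)‖ * ‖α‖ ^ i < 1 * ‖α‖ ^ i :=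
    mul_lt_mul_of_pos_right h3 (by positivity)
  linarith

theorem eval₂_eq_zero_of_mem_span {a : (IntegerRing k)[X]} {α : AlgebraicClosure k}
    (hα : a.eval₂ (intToClosure k) α = 0) (p : (IntegerRing k)[X]) (hp : p ∈ Ideal.span {a}) :
    eval₂RingHom (intToClosure k) α p = 0 := by
  obtain ⟨q, rfl⟩ := Ideal.mem_span_singleton'.1 hp
  simp [hα]

/-- Evaluation of power series at a root of a distinguished polynomial, defined through
`𝒪_k[[T]]/(a) ≅ 𝒪_k[T]/(a)`. -/
def evalHom {a : (IntegerRing k)[X]} (ha : IsDist a) {α : AlgebraicClosure k}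
    (hα : a.eval₂ (intToClosure k) α = 0) : PowerRing k →+* AlgebraicClosure k :=
  (Ideal.Quotient.lift (Ideal.span {a}) (eval₂RingHom (intToClosure k) α)
    (eval₂_eq_zero_of_mem_span hα)).comp
  (ha.algEquivQuotient.symm.toRingEquiv.toRingHom.comp (Ideal.Quotient.mk _))

section
variable {a : (IntegerRing k)[X]} (ha : IsDist a) {α : AlgebraicClosure k}
    (hα : a.eval₂ (intToClosure k) α = 0)

theorem evalHom_coe (p : (IntegerRing k)[X]) :
    evalHom ha hα (p : PowerRing k) = p.eval₂ (intToClosure k) α := by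
  have h : ha.algEquivQuotient (Ideal.Quotient.mk (Ideal.span {a}) p) =
      Ideal.Quotient.mk (Ideal.span {(a : PowerRing k)}) (p : PowerRing k) := rfl
  have h2 : ha.algEquivQuotient.symm (Ideal.Quotient.mk _ (p : PowerRing k)) =
      Ideal.Quotient.mk (Ideal.span {a}) p := by rw [← h, AlgEquiv.symm_apply_apply]
  change Ideal.Quotient.lift (Ideal.span {a}) (eval₂RingHom (intToClosure k) α)
    (eval₂_eq_zero_of_mem_span hα)
    (ha.algEquivQuotient.symm (Ideal.Quotient.mk _ (p : PowerRing k))) = _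
  rw [h2]
  rfl

theorem evalHom_eq_weierstrassMod (u : PowerRing k) :
    evalHom ha hα u = (u.weierstrassMod (a : PowerRing k)).eval₂ (intToClosure k) α := by
  conv_lhs => rw [ha.eq_mul_add u]
  rw [map_add, map_mul, evalHom_coe, evalHom_coe, hα, zero_mul, zero_add]

theorem norm_evalHom_le (u : PowerRing k) : ‖evalHom ha hα u‖ ≤ 1 := by
  rw [evalHom_eq_weierstrassMod]
  exact norm_eval₂_le _ (ha.norm_root_lt_one hα).le

theorem evalHom_C (x : IntegerRing k) : evalHom ha hα (PowerSeries.C x) = intToClosure k x := by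
  simpa using evalHom_coe ha hα (Polynomial.C x)

theorem evalHom_X : evalHom ha hα (PowerSeries.X) = α := by
  simpa using evalHom_coe ha hα Polynomial.X

/-- The difference is T^n times an integral series, whose value has norm at most 1. Convergence of
the power series at α comes from this estimate alone. -/
theorem norm_evalHom_sub_le (u v : PowerRing k) (n : ℕ)
    (h : ∀ m < n, u.coeff m = v.coeff m) : ‖evalHom ha hα u - evalHom ha hα v‖ ≤ ‖α‖ ^ n := by
  have : (PowerSeries.X : PowerRing k) ^ n ∣ u - v := by
    rw [PowerSeries.X_pow_dvd_iff]
    intro m hm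
    simp [h m hm]
  obtain ⟨w, hw⟩ := this
  rw [← map_sub, hw, map_mul, map_pow, evalHom_X, norm_mul, norm_pow]
  exact mul_le_of_le_one_right (by positivity) (norm_evalHom_le ha hα w)

/-- A finite partial sum containing the first N terms agrees with u up to order N, so the error is
at most ‖α‖ ^ N. This identifies the algebraic evaluation, a ring homomorphism by construction, with
the sum in `evalInClosure`. -/
theorem hasSum_evalHom (u : PowerRing k) :
    HasSum (fun n : ℕ => algebraMap k (AlgebraicClosure k) (u.coeff n) * α ^ n)
      (evalHom ha hα u) := by
  rw [HasSum, SummationFilter.unconditional_filter, Metric.tendsto_atTop]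
  intro ε hε
  obtain ⟨N, hN⟩ := exists_pow_lt_of_lt_one hε (ha.norm_root_lt_one hα)
  refine ⟨Finset.range N, fun s hs => ?_⟩
  have h1 : ∑ n ∈ s, algebraMap k (AlgebraicClosure k) (u.coeff n) * α ^ n =
      evalHom ha hα (∑ n ∈ s, PowerSeries.C (u.coeff n) * PowerSeries.X ^ n) := by
    rw [map_sum]
    exact Finset.sum_congr rfl fun n _ => by
      rw [map_mul, map_pow, evalHom_C, evalHom_X, intToClosure_apply]
  rw [h1, dist_eq_norm]
  refine (norm_evalHom_sub_le ha hα _ _ N fun m hm => ?_).trans_lt hN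
  rw [map_sum]
  simp only [PowerSeries.coeff_C_mul, PowerSeries.coeff_X_pow, mul_ite, mul_one, mul_zero]
  rw [Finset.sum_ite_eq, if_pos (hs (Finset.mem_range.2 hm))]

theorem evalInClosure_eq (u : PowerRing k) : evalInClosure u α = evalHom ha hα u :=
  (hasSum_evalHom ha hα u).tsum_eq

end

/-- `∏_{α ∈ V(a)} u(α)` for distinguished `a`, as a resultant. -/
def normRoot (a : (IntegerRing k)[X]) (u : PowerRing k) : IntegerRing k :=
  resultant a (u.weierstrassMod (a : PowerRing k)) a.natDegree a.natDegree

/-- A formal degree n above the true degree of r only introduces powers of the leading coefficient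
of a, which is 1. So n may be kept fixed while r varies. -/
theorem algebraMap_resultant {a r : (IntegerRing k)[X]} (ha : a.Monic) {n : ℕ}
    (hr : r.natDegree ≤ n) :
    intToClosure k (resultant a r a.natDegree n) =
      ((rootsInClosure a).map (r.eval₂ (intToClosure k))).prod := by
  rw [← resultant_map_map]
  have hd : (a.map (intToClosure k)).natDegree = a.natDegree := ha.natDegree_map _
  rw [← hd, resultant_eq_prod_eval _ _ _ (natDegree_map_le.trans hr) (IsAlgClosed.splits _),
    ha.map _, one_pow, one_mul]
  simp only [eval_map, rootsInClosure_def]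

theorem intToClosure_normRoot {a : (IntegerRing k)[X]} (ha : IsDist a) (u : PowerRing k) :
    intToClosure k (normRoot a u) = prodOverRoots u a := by
  have hr : (u.weierstrassMod (a : PowerRing k)).natDegree ≤ a.natDegree :=
    natDegree_le_of_degree_le (ha.weierstrassMod_degree_lt u).le
  rw [normRoot, algebraMap_resultant ha.monic hr, prodOverRoots]
  congr 1
  refine Multiset.map_congr rfl fun α hα => ?_
  have hα := (mem_rootsInClosure ha.monic.ne_zero).1 hα
  rw [evalInClosure_eq ha hα, evalHom_eq_weierstrassMod]

theorem prodOverRoots_mul_left {a : (IntegerRing k)[X]} (ha : IsDist a) (u v : PowerRing k) :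
    prodOverRoots (u * v) a = prodOverRoots u a * prodOverRoots v a := by
  rw [prodOverRoots, prodOverRoots, prodOverRoots, ← Multiset.prod_map_mul]
  congr 1
  refine Multiset.map_congr rfl fun α hα => ?_
  have hα := (mem_rootsInClosure ha.monic.ne_zero).1 hα
  simp [evalInClosure_eq ha hα]

theorem rootsInClosure_mul {a b : (IntegerRing k)[X]} (ha : a.Monic) (hb : b.Monic) :
    rootsInClosure (a * b) = rootsInClosure a + rootsInClosure b := by
  rw [rootsInClosure_def, Polynomial.map_mul, roots_mul]
  · rfl
  · exact ((ha.map _).mul (hb.map _)).ne_zero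

theorem normRoot_mul_right {a : (IntegerRing k)[X]} (ha : IsDist a) (u v : PowerRing k) :
    normRoot a (u * v) = normRoot a u * normRoot a v := by
  apply intToClosure_injective
  rw [map_mul, intToClosure_normRoot ha, intToClosure_normRoot ha, intToClosure_normRoot ha,
    prodOverRoots_mul_left ha]

theorem normRoot_mul_left {a b : (IntegerRing k)[X]} (ha : IsDist a) (hb : IsDist b)
    (u : PowerRing k) : normRoot (a * b) u = normRoot a u * normRoot b u := by
  apply intToClosure_injective
  rw [map_mul, intToClosure_normRoot ha, intToClosure_normRoot hb,
    intToClosure_normRoot (ha.mul hb),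
    prodOverRoots, rootsInClosure_mul ha.monic hb.monic, Multiset.map_add, Multiset.prod_add]
  rfl

theorem card_rootsInClosure {a : (IntegerRing k)[X]} (ha : a.Monic) :
    (rootsInClosure a).card = a.natDegree := by
  rw [rootsInClosure_def, ← ha.natDegree_map (intToClosure k)]
  exact ((IsAlgClosed.splits (a.map (intToClosure k))).natDegree_eq_card_roots).symm

theorem normRoot_C {a : (IntegerRing k)[X]} (ha : IsDist a) (x : IntegerRing k) :
    normRoot a (PowerSeries.C x) = x ^ a.natDegree := by
  apply intToClosure_injective
  rw [intToClosure_normRoot ha, prodOverRoots, map_pow, ← card_rootsInClosure ha.monic,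
    ← Multiset.prod_replicate, ← Multiset.map_const']
  congr 1
  refine Multiset.map_congr rfl fun α hα => ?_
  have hα := (mem_rootsInClosure ha.monic.ne_zero).1 hα
  rw [evalInClosure_eq ha hα, evalHom_C]

theorem normRoot_one_left (u : PowerRing k) : normRoot 1 u = 1 := by
  have h1 : IsDist (1 : (IntegerRing k)[X]) := ⟨⟨fun h => by simp at h⟩, monic_one⟩
  apply intToClosure_injective
  rw [intToClosure_normRoot h1, prodOverRoots, rootsInClosure_def]
  simp

theorem normRoot_coe {a p : (IntegerRing k)[X]} (ha : IsDist a) :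
    normRoot a (p : PowerRing k) = resultant a p := by
  apply intToClosure_injective
  rw [intToClosure_normRoot ha, algebraMap_resultant ha.monic le_rfl, prodOverRoots]
  congr 1
  refine Multiset.map_congr rfl fun α hα => ?_
  have hα := (mem_rootsInClosure ha.monic.ne_zero).1 hα
  rw [evalInClosure_eq ha hα, evalHom_coe]

/-- Symmetry of the resultant; this sign is what the factor (-1)^{w(f)w(g)} of the symbol
compensates. -/
theorem normRoot_comm {a b : (IntegerRing k)[X]} (ha : IsDist a) (hb : IsDist b) :
    normRoot a (b : PowerRing k) =
      (-1) ^ (a.natDegree * b.natDegree) * normRoot b (a : PowerRing k) := by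
  rw [normRoot_coe ha, normRoot_coe hb, resultant_comm]

theorem normRoot_eq_of_dvd_sub {a : (IntegerRing k)[X]} (ha : IsDist a) {u v : PowerRing k}
    (h : (a : PowerRing k) ∣ u - v) : normRoot a u = normRoot a v := by
  apply intToClosure_injective
  rw [intToClosure_normRoot ha, intToClosure_normRoot ha, prodOverRoots, prodOverRoots]
  congr 1
  refine Multiset.map_congr rfl fun α hα => ?_
  have hα := (mem_rootsInClosure ha.monic.ne_zero).1 hα
  obtain ⟨w, hw⟩ := h
  rw [evalInClosure_eq ha hα, evalInClosure_eq ha hα, ← sub_eq_zero, ← map_sub, hw, map_mul,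
    evalHom_coe, hα, zero_mul]

theorem normRoot_eq_zero {a : (IntegerRing k)[X]} (ha : IsDist a) {u : PowerRing k}
    (h : normRoot a u = 0) : ∃ (α : AlgebraicClosure k) (hα : a.eval₂ (intToClosure k) α = 0),
      evalHom ha hα u = 0 := by
  have h2 : prodOverRoots u a = 0 := by rw [← intToClosure_normRoot ha, h, map_zero]
  rw [prodOverRoots, Multiset.prod_eq_zero_iff, Multiset.mem_map] at h2
  obtain ⟨α, hα, h3⟩ := h2
  have hα := (mem_rootsInClosure ha.monic.ne_zero).1 hα
  exact ⟨α, hα, by rw [← evalInClosure_eq ha hα, h3]⟩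

end Evaluation

/-! ### Extending bimultiplicative maps to groups of fractions -/

section GroupCompletion
variable {T G H : Type*} [CommMonoid T] [CommGroup G] [CommGroup H] {j : T →* G}

/-- `j` exhibits `G` as the group of fractions of the cancellative monoid `T`. -/
structure IsGroupCompletion (j : T →* G) : Prop where
  injective : Function.Injective j
  exists_div : ∀ g, ∃ s t, g = j s / j t

theorem IsGroupCompletion.div_eq_div (h : IsGroupCompletion j) (φ : T →* H) {s t s' t' : T}
    (he : j s / j t = j s' / j t') : φ s / φ t = φ s' / φ t' := by
  rw [div_eq_div_iff_mul_eq_mul, ← map_mul, ← map_mul] at he ⊢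
  rw [h.injective he]

/-- The extension of a homomorphism to the group of fractions. -/
def IsGroupCompletion.extend (h : IsGroupCompletion j) (φ : T →* H) : G →* H :=
  MonoidHom.mk' (fun g => φ (h.exists_div g).choose / φ (h.exists_div g).choose_spec.choose)
    fun x y => by
      rw [div_mul_div_comm, ← map_mul, ← map_mul]
      apply h.div_eq_div
      rw [map_mul, map_mul, ← div_mul_div_comm, ← (h.exists_div _).choose_spec.choose_spec,
        ← (h.exists_div _).choose_spec.choose_spec, ← (h.exists_div _).choose_spec.choose_spec]

theorem IsGroupCompletion.extend_apply (h : IsGroupCompletion j) (φ : T →* H) (s : T) :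
    h.extend φ (j s) = φ s := by
  have : h.extend φ (j s) = φ s / φ 1 := by
    apply h.div_eq_div
    rw [← (h.exists_div _).choose_spec.choose_spec]
    simp
  simpa using this

/-- The extension of a bimultiplicative map to the group of fractions. -/
def IsGroupCompletion.extend₂ (h : IsGroupCompletion j) (φ : T →* T →* H) : G →* G →* H :=
  h.extend
    { toFun := fun s => h.extend (φ s)
      map_one' := by
        ext g
        obtain ⟨s, t, rfl⟩ := h.exists_div g
        simp [h.extend_apply]
      map_mul' := fun x y => by
        ext g
        obtain ⟨s, t, rfl⟩ := h.exists_div g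
        simp [h.extend_apply, mul_div_mul_comm] }

theorem IsGroupCompletion.extend₂_apply (h : IsGroupCompletion j) (φ : T →* T →* H) (s t : T) :
    h.extend₂ φ (j s) (j t) = φ s t := by
  rw [extend₂, h.extend_apply]
  exact h.extend_apply _ _

end GroupCompletion

/-! ### Weierstrass preparation and the symbol on Mˣ -/

section Weierstrass
open Polynomial

variable {k : Type*} [NontriviallyNormedField k] [IsUltrametricDist k]

theorem powerToM_injective : Function.Injective (powerToM k) :=
  IsFractionRing.injective (PowerRing k) (FracField k)

theorem constToM_coe (x : IntegerRing k) : constToM k x = powerToM k (PowerSeries.C x) :=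
  IsFractionRing.lift_algebraMap (A := IntegerRing k) (K := k) (g := (powerToM k).comp PowerSeries.C)
    ((IsFractionRing.injective (PowerRing k) (FracField k)).comp PowerSeries.C_injective) x

variable (k) in
/-- The monoid of distinguished polynomials. -/
def DistPoly : Submonoid (IntegerRing k)[X] where
  carrier := {a | IsDist a}
  one_mem' := ⟨⟨fun h => by simp at h⟩, monic_one⟩
  mul_mem' ha hb := ha.mul hb

theorem distPoly_isDist (a : DistPoly k) : IsDist (a : (IntegerRing k)[X]) := a.2

variable (k) in
/-- The group `1 + T 𝒪_k[[T]]`. -/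
def OneUnit : Subgroup (PowerRing k)ˣ :=
  (Units.map (PowerSeries.constantCoeff (R := IntegerRing k)).toMonoidHom).ker

theorem mem_oneUnit {u : (PowerRing k)ˣ} :
    u ∈ OneUnit k ↔ PowerSeries.constantCoeff (u : PowerRing k) = 1 := by
  rw [OneUnit, MonoidHom.mem_ker, Units.ext_iff]
  rfl

theorem OneUnit.constantCoeff (u : OneUnit k) :
    PowerSeries.constantCoeff ((u : (PowerRing k)ˣ) : PowerRing k) = 1 := mem_oneUnit.1 u.2

theorem isUnit_of_constantCoeff_eq_one {u : PowerRing k} (hu : PowerSeries.constantCoeff u = 1) :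
    IsUnit u := PowerSeries.isUnit_iff_constantCoeff.2 (by rw [hu]; exact isUnit_one)

/-- A power series with constant coefficient one as an element of `OneUnit k`. -/
def OneUnit.mk (u : PowerRing k) (hu : PowerSeries.constantCoeff u = 1) : OneUnit k :=
  ⟨(isUnit_of_constantCoeff_eq_one hu).unit, mem_oneUnit.2 hu⟩

@[simp] theorem OneUnit.coe_mk (u : PowerRing k) (hu : PowerSeries.constantCoeff u = 1) :
    ((OneUnit.mk u hu : (PowerRing k)ˣ) : PowerRing k) = u := rfl

variable (k) in
/-- The monoid of triples `(c, a, u)` of a constant, a distinguished polynomial and a power series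
with constant coefficient one. -/
abbrev Triple : Type _ := kˣ × DistPoly k × OneUnit k

/-- The power series `c a u` as an element of `M`. -/
def Triple.val (s : Triple k) : FracField k :=
  constToM k s.1 * powerToM k ((s.2.1 : (IntegerRing k)[X]) : PowerRing k) *
    powerToM k ((s.2.2 : (PowerRing k)ˣ) : PowerRing k)

theorem Triple.val_ne_zero (s : Triple k) : s.val ≠ 0 := by
  have h1 : ((s.2.1 : (IntegerRing k)[X]) : PowerRing k) ≠ 0 := by
    rw [Ne, Polynomial.coe_eq_zero_iff]
    exact (distPoly_isDist s.2.1).monic.ne_zero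
  refine mul_ne_zero (mul_ne_zero ?_ ?_) ?_
  · exact (_root_.map_ne_zero _).2 s.1.ne_zero
  · exact (map_ne_zero_iff _ powerToM_injective).2 h1
  · exact (map_ne_zero_iff _ powerToM_injective).2 (s.2.2 : (PowerRing k)ˣ).ne_zero

variable (k) in
/-- The homomorphism `(c, a, u) ↦ c a u`. -/
def tripleToM : Triple k →* (FracField k)ˣ where
  toFun s := Units.mk0 s.val s.val_ne_zero
  map_one' := by
    ext
    simp [Triple.val]
  map_mul' s t := by
    ext
    simp [Triple.val]
    ring

@[simp] theorem coe_tripleToM (s : Triple k) : (tripleToM k s : FracField k) = s.val := rfl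

variable [ProperSpace k]

/-- Divide by a coefficient of maximal norm; the quotient is still integral and has a coefficient
equal to 1, hence survives reduction. -/
theorem exists_eq_C_mul {x : PowerRing k} (hx : x ≠ 0) :
    ∃ (c : IntegerRing k) (y : PowerRing k), c ≠ 0 ∧ x = PowerSeries.C c * y ∧
      y.map (IsLocalRing.residue (IntegerRing k)) ≠ 0 := by
  obtain ⟨n, hn⟩ := exists_coeff_eq_gauss x
  have hc : x.coeff n ≠ 0 := by
    intro h0
    apply hx
    ext m
    have := coeff_le_gauss x m
    rw [← hn, h0] at this
    simpa using this
  have hd : ∀ m, x.coeff n ∣ x.coeff m := fun m =>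
    (integer_dvd_iff hc).2 (by exact_mod_cast (coeff_le_gauss x m).trans_eq hn.symm)
  choose q hq using hd
  refine ⟨x.coeff n, PowerSeries.mk q, hc, ?_, ?_⟩
  · ext m
    rw [PowerSeries.coeff_C_mul, PowerSeries.coeff_mk, ← hq]
  · intro h0
    have h1 := congrArg (PowerSeries.coeff n) h0
    have h2 : q n = 1 := mul_left_cancel₀ hc (by rw [← hq, mul_one])
    rw [PowerSeries.coeff_map, PowerSeries.coeff_mk, h2] at h1
    simp at h1

theorem isUnit_eq_C_mul {U : PowerRing k} (hU : IsUnit U) :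
    ∃ u : OneUnit k, U = PowerSeries.C (PowerSeries.constantCoeff U) *
      ((u : (PowerRing k)ˣ) : PowerRing k) := by
  obtain ⟨c, hc⟩ := PowerSeries.isUnit_iff_constantCoeff.1 hU
  refine ⟨OneUnit.mk (PowerSeries.C ((c⁻¹ : (IntegerRing k)ˣ) : IntegerRing k) * U) ?_, ?_⟩
  · simp [← hc]
  · rw [OneUnit.coe_mk, ← mul_assoc, ← map_mul, ← hc, Units.mul_inv, map_one, one_mul]

/-- A nonzero integer as a unit of `k`. -/
def intUnit (c : IntegerRing k) (hc : c ≠ 0) : kˣ := Units.mk0 (c : k) (by simpa using hc)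

@[simp] theorem coe_intUnit (c : IntegerRing k) (hc : c ≠ 0) : (intUnit c hc : k) = c := rfl

theorem exists_triple_of_residue_ne_zero {y : PowerRing k}
    (hy : y.map (IsLocalRing.residue (IntegerRing k)) ≠ 0) :
    ∃ (a : DistPoly k) (U : (PowerRing k)ˣ), y = ((a : (IntegerRing k)[X]) : PowerRing k) * U := by
  obtain ⟨a, U, h⟩ := PowerSeries.exists_isWeierstrassFactorization hy
  exact ⟨⟨a, h.isDistinguishedAt⟩, h.isUnit.unit, h.eq_mul⟩

/-- The link between U and the one-unit u is recorded because the continuity estimate works with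
congruences between the full units U. -/
theorem exists_triple_C_mul (c : IntegerRing k) (hc : c ≠ 0) (a : DistPoly k) (U : (PowerRing k)ˣ) :
    ∃ (h0 : c * PowerSeries.constantCoeff (U : PowerRing k) ≠ 0) (u : OneUnit k),
      (U : PowerRing k) = PowerSeries.C (PowerSeries.constantCoeff (U : PowerRing k)) *
        ((u : (PowerRing k)ˣ) : PowerRing k) ∧
      Triple.val (intUnit _ h0, a, u) =
      powerToM k (PowerSeries.C c * (((a : (IntegerRing k)[X]) : PowerRing k) * U)) := by
  obtain ⟨u, hu⟩ := isUnit_eq_C_mul U.isUnit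
  refine ⟨mul_ne_zero hc (PowerSeries.isUnit_iff_constantCoeff.1 U.isUnit).ne_zero, u, hu, ?_⟩
  conv_rhs => rw [hu]
  simp only [Triple.val, coe_intUnit, constToM_coe, map_mul]
  ring

theorem exists_triple {x : PowerRing k} (hx : x ≠ 0) : ∃ s : Triple k, s.val = powerToM k x := by
  obtain ⟨c, y, hc, rfl, hy⟩ := exists_eq_C_mul hx
  obtain ⟨a, U, rfl⟩ := exists_triple_of_residue_ne_zero hy
  obtain ⟨h0, u, -, h⟩ := exists_triple_C_mul c hc a U
  exact ⟨_, h⟩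

/-- Once the ratio d of the constants is integral, the equation lives in 𝒪_k[[T]]. Reduction modulo
the maximal ideal forces d to be a unit, uniqueness of Weierstrass factorisation matches the
polynomials, and constant coefficients give d = 1. -/
theorem tripleToM_injective_aux {s t : Triple k} (h : s.val = t.val) (d : IntegerRing k)
    (hd : (s.1 : k) = t.1 * d) : s = t := by
  obtain ⟨c, a, u⟩ := s
  obtain ⟨c', a', u'⟩ := t
  simp only [Triple.val] at h hd
  rw [hd, map_mul, mul_assoc, mul_assoc, mul_assoc,
    mul_right_inj' ((_root_.map_ne_zero _).2 c'.ne_zero), constToM_coe, ← map_mul, ← map_mul, ← map_mul] at h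
  have h := powerToM_injective h
  have hdu : IsUnit d := by
    by_contra hdu
    have h1 := congrArg (PowerSeries.map (IsLocalRing.residue (IntegerRing k))) h
    rw [map_mul, PowerSeries.map_C, (IsLocalRing.residue_eq_zero_iff d).2
      ((IsLocalRing.mem_maximalIdeal _).2 hdu), map_zero, zero_mul] at h1
    exact (distPoly_isDist a').map_ne_zero_of_eq_mul _ ((u' : (PowerRing k)ˣ) : PowerRing k)
      (by rw [OneUnit.constantCoeff, ← Ideal.ne_top_iff_one]
          exact Ideal.IsPrime.ne_top') rfl h1.symm
  have hf : PowerSeries.IsWeierstrassFactorization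
      (((a' : (IntegerRing k)[X]) : PowerRing k) * ((u' : (PowerRing k)ˣ) : PowerRing k))
      (a : (IntegerRing k)[X]) (PowerSeries.C d * ((u : (PowerRing k)ˣ) : PowerRing k)) :=
    ⟨(distPoly_isDist a), (hdu.map _).mul (u : (PowerRing k)ˣ).isUnit, by rw [← h]; ring⟩
  have hf' : PowerSeries.IsWeierstrassFactorization
      (((a' : (IntegerRing k)[X]) : PowerRing k) * ((u' : (PowerRing k)ˣ) : PowerRing k))
      (a' : (IntegerRing k)[X]) ((u' : (PowerRing k)ˣ) : PowerRing k) :=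
    ⟨(distPoly_isDist a'), (u' : (PowerRing k)ˣ).isUnit, rfl⟩
  obtain ⟨h1, h2⟩ := hf.elim hf'
  have h3 := congrArg PowerSeries.constantCoeff h2
  rw [map_mul, OneUnit.constantCoeff, OneUnit.constantCoeff] at h3
  have hd1 : d = 1 := by simpa using h3
  subst hd1
  refine Prod.ext (Units.ext (by simpa using hd)) (Prod.ext (Subtype.ext h1)
    (Subtype.ext (Units.ext (by simpa using h2))))

theorem tripleToM_injective : Function.Injective (tripleToM k) := by
  intro s t h
  have h : s.val = t.val := congrArg Units.val h
  -- One of the two ratios of constants is integral.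
  rcases le_total ‖(s.1 : k)‖ ‖(t.1 : k)‖ with hle | hle
  · exact tripleToM_injective_aux h ⟨s.1 / t.1, mem_integerRing.2 (by
      rw [norm_div]; exact div_le_one_of_le₀ hle (norm_nonneg _))⟩
      (by simp [mul_div_cancel₀])
  · exact (tripleToM_injective_aux h.symm ⟨t.1 / s.1, mem_integerRing.2 (by
      rw [norm_div]; exact div_le_one_of_le₀ hle (norm_nonneg _))⟩
      (by simp [mul_div_cancel₀])).symm

theorem isGroupCompletion_tripleToM : IsGroupCompletion (tripleToM k) where
  injective := tripleToM_injective
  exists_div f := by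
    obtain ⟨x, z, hz, hf⟩ := IsFractionRing.div_surjective (A := PowerRing k) (f : FracField k)
    have hz0 := nonZeroDivisors.ne_zero hz
    have hx0 : x ≠ 0 := by
      rintro rfl
      apply f.ne_zero
      rw [← hf, map_zero, zero_div]
    obtain ⟨s, hs⟩ := exists_triple hx0
    obtain ⟨t, ht⟩ := exists_triple hz0
    refine ⟨s, t, Units.ext ?_⟩
    rw [Units.val_div_eq_div_val, coe_tripleToM, coe_tripleToM, hs, ht, ← hf]
    rfl

/-- `u ↦ ∏_{α ∈ V(a)} u(α)` as a monoid homomorphism. -/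
def normRootHom (a : DistPoly k) : PowerRing k →* IntegerRing k where
  toFun := normRoot (a : (IntegerRing k)[X])
  map_one' := by simpa using normRoot_C (distPoly_isDist a) 1
  map_mul' := normRoot_mul_right (distPoly_isDist a)

variable (k) in
/-- The bimultiplicative map `(a, u) ↦ ∏_{α ∈ V(a)} u(α)`. -/
def normUnit : DistPoly k →* (PowerRing k)ˣ →* kˣ where
  toFun a := Units.map ((IntegerRing k).subtype.toMonoidHom.comp (normRootHom a))
  map_one' := by
    ext u
    simp [normRootHom, normRoot_one_left]
  map_mul' a b := by
    ext u
    simp [normRootHom, normRoot_mul_left (distPoly_isDist a) (distPoly_isDist b)]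

theorem coe_normUnit (a : DistPoly k) (u : (PowerRing k)ˣ) :
    (normUnit k a u : k) = normRoot (a : (IntegerRing k)[X]) (u : PowerRing k) := rfl

theorem algebraMap_normUnit (a : DistPoly k) (u : (PowerRing k)ˣ) :
    algebraMap k (AlgebraicClosure k) (normUnit k a u) =
      prodOverRoots (u : PowerRing k) (a : (IntegerRing k)[X]) := by
  rw [coe_normUnit, ← intToClosure_normRoot (distPoly_isDist a)]
  rfl

/-- The degree of the distinguished polynomial of a triple. -/
def Triple.deg (s : Triple k) : ℕ := (s.2.1 : (IntegerRing k)[X]).natDegree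

theorem Triple.deg_mul (s t : Triple k) : (s * t).deg = s.deg + t.deg :=
  (distPoly_isDist s.2.1).monic.natDegree_mul (distPoly_isDist t.2.1).monic

theorem Triple.deg_one : (1 : Triple k).deg = 0 := by
  simp [Triple.deg]

/-- The symbol on triples. -/
def tripleSymbolAux (s t : Triple k) : kˣ :=
  (-1) ^ (s.deg * t.deg) * (t.1 ^ s.deg / s.1 ^ t.deg) *
    (normUnit k s.2.1 t.2.2 / normUnit k t.2.1 s.2.2)

variable (k) in
/-- The symbol on triples as a bimultiplicative map. -/
def tripleSymbol : Triple k →* Triple k →* kˣ where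
  toFun s :=
    { toFun := tripleSymbolAux s
      map_one' := by simp [tripleSymbolAux, Triple.deg_one]
      map_mul' := fun t t' => by
        simp only [tripleSymbolAux, Triple.deg_mul, Prod.fst_mul, Prod.snd_mul, map_mul, mul_add,
          pow_add, mul_pow, Subgroup.coe_mul, MonoidHom.mul_apply, mul_div_mul_comm]
        ac_rfl }
  map_one' := by
    ext t
    simp [tripleSymbolAux, Triple.deg_one]
  map_mul' s s' := by
    ext1 t
    simp only [tripleSymbolAux, Triple.deg_mul, Prod.fst_mul, Prod.snd_mul, map_mul, add_mul,
      pow_add, mul_pow, Subgroup.coe_mul, MonoidHom.mul_apply, mul_div_mul_comm, MonoidHom.coe_mk,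
      OneHom.coe_mk]
    ac_rfl

variable (k) in
/-- The symbol `{f, g}_M`. -/
def symM : (FracField k)ˣ →* (FracField k)ˣ →* kˣ :=
  isGroupCompletion_tripleToM.extend₂ (tripleSymbol k)

theorem symM_tripleToM (s t : Triple k) :
    symM k (tripleToM k s) (tripleToM k t) = (-1) ^ (s.deg * t.deg) * (t.1 ^ s.deg / s.1 ^ t.deg) *
    (normUnit k s.2.1 t.2.2 / normUnit k t.2.1 s.2.2) :=
  isGroupCompletion_tripleToM.extend₂_apply _ _ _

end Weierstrass

/-! ### Agreement with the Weierstrass definition, and the Steinberg relation on M -/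

section SymbolOnM
open Polynomial

variable {k : Type*} [NontriviallyNormedField k] [IsUltrametricDist k] [ProperSpace k]

/-- Modulo the maximal ideal, a' divides a power of T over a field, so being monic it reduces to a
power of T itself. -/
theorem IsDist.of_mul_eq {a d a' : (IntegerRing k)[X]} (ha : IsDist a) (h : d * a' = a)
    (hm : a'.Monic) : IsDist a' := by
  have h1 := ha.map_eq_X_pow
  rw [← h, Polynomial.map_mul] at h1
  let _ := Ideal.Quotient.field (IsLocalRing.maximalIdeal (IntegerRing k))
  have h2 : a'.map (Ideal.Quotient.mk (IsLocalRing.maximalIdeal (IntegerRing k))) ∣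
      Polynomial.X ^ (d * a').natDegree := by
    rw [← h1]
    exact Dvd.intro_left _ rfl
  obtain ⟨i, -, hi⟩ := (dvd_prime_pow Polynomial.prime_X _).1 h2
  have h3 := eq_of_monic_of_associated (hm.map _) (monic_X_pow i) hi
  have h4 : a'.natDegree = i := by
    rw [← hm.natDegree_map (Ideal.Quotient.mk (IsLocalRing.maximalIdeal (IntegerRing k))), h3,
      natDegree_X_pow]
  refine ⟨⟨fun {n} hn => ?_⟩, hm⟩
  rw [← Ideal.Quotient.eq_zero_iff_mem, ← coeff_map, h3, coeff_X_pow, if_neg (by omega)]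

/-- Cancel the greatest common divisor in the factorial ring 𝒪_k[T]. As a and b are monic, the
leading coefficients of the divisor and cofactors are units, and rescaling makes the cofactors
monic. -/
theorem exists_isRelPrime (a b : DistPoly k) : ∃ a' b' : DistPoly k,
    IsRelPrime (a' : (IntegerRing k)[X]) b' ∧ a * b' = a' * b := by
  have ha := distPoly_isDist a
  have hb := distPoly_isDist b
  obtain ⟨x, y, d, hrel, hx, hy⟩ := UniqueFactorizationMonoid.exists_reduced_factors
    (a : (IntegerRing k)[X]) ha.monic.ne_zero (b : (IntegerRing k)[X])
  have h1 : d.leadingCoeff * x.leadingCoeff = 1 := by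
    rw [← leadingCoeff_mul, hx, ha.monic]
  have h2 : d.leadingCoeff * y.leadingCoeff = 1 := by
    rw [← leadingCoeff_mul, hy, hb.monic]
  have hu : IsUnit (C d.leadingCoeff) := (IsUnit.of_mul_eq_one _ h1).map C
  have hmx : (C d.leadingCoeff * x).Monic := by
    rw [Monic, leadingCoeff_mul, leadingCoeff_C, h1]
  have hmy : (C d.leadingCoeff * y).Monic := by
    rw [Monic, leadingCoeff_mul, leadingCoeff_C, h2]
  have hCx : C x.leadingCoeff * C d.leadingCoeff = 1 := by
    rw [← map_mul, mul_comm, h1, map_one]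
  refine ⟨⟨_, ha.of_mul_eq (d := d * C x.leadingCoeff) ?_ hmx⟩,
    ⟨_, hb.of_mul_eq (d := d * C x.leadingCoeff) ?_ hmy⟩, ?_, ?_⟩
  · rw [← hx, mul_assoc, ← mul_assoc (C x.leadingCoeff), hCx, one_mul]
  · rw [← hy, mul_assoc, ← mul_assoc (C x.leadingCoeff), hCx, one_mul]
  · exact (isRelPrime_mul_unit_left hu).2 hrel
  · apply Subtype.ext
    change (a : (IntegerRing k)[X]) * (C d.leadingCoeff * y) = C d.leadingCoeff * x * b
    rw [← hx, ← hy]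
    ring

/-- A common root is integral over the integrally closed ring 𝒪_k, so its minimal polynomial over
𝒪_k would be a common non-unit divisor. -/
theorem no_common_root {a b : (IntegerRing k)[X]} (ha : a.Monic) (h : IsRelPrime a b)
    {α : AlgebraicClosure k} (h1 : a.eval₂ (intToClosure k) α = 0) :
    b.eval₂ (intToClosure k) α ≠ 0 := by
  intro h2
  have : FaithfulSMul (IntegerRing k) (AlgebraicClosure k) :=
    (faithfulSMul_iff_algebraMap_injective _ _).2 intToClosure_injective
  have hint : IsIntegral (IntegerRing k) α := ⟨a, ha, h1⟩
  have hu := h (minpoly.isIntegrallyClosed_dvd hint h1) (minpoly.isIntegrallyClosed_dvd hint h2)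
  exact minpoly.not_isUnit _ _ hu

theorem exists_triple_div (f : (FracField k)ˣ) : ∃ (c : kˣ) (a b : DistPoly k) (u : OneUnit k),
    IsRelPrime (a : (IntegerRing k)[X]) b ∧
      f = tripleToM k (c, a, u) / tripleToM k (1, b, 1) := by
  obtain ⟨⟨c, a, u⟩, ⟨c', b, u'⟩, rfl⟩ := isGroupCompletion_tripleToM.exists_div f
  obtain ⟨a', b', hrel, h⟩ := exists_isRelPrime a b
  refine ⟨c / c', a', b', u / u', hrel, ?_⟩
  rw [div_eq_div_iff_mul_eq_mul, ← map_mul, ← map_mul]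
  congr 1
  refine Prod.ext ?_ (Prod.ext h ?_)
  · simp
  · simp

/-- The Weierstrass data attached to a fraction of triples. -/
def mkData (c : kˣ) (a b : DistPoly k) (u : OneUnit k) (h : IsRelPrime (a : (IntegerRing k)[X]) b) :
    WeierstrassData k where
  const := c
  num := a
  den := b
  unit := ((u : (PowerRing k)ˣ) : PowerRing k)
  num_distinguished := distPoly_isDist a
  den_distinguished := distPoly_isDist b
  relPrime := h
  unit_const := OneUnit.constantCoeff u

theorem mkData_represents (c : kˣ) (a b : DistPoly k) (u : OneUnit k)
    (h : IsRelPrime (a : (IntegerRing k)[X]) b) :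
    (mkData c a b u h).Represents
      ((tripleToM k (c, a, u) / tripleToM k (1, b, 1) : (FracField k)ˣ) : FracField k) := by
  rw [WeierstrassData.Represents, Units.val_div_eq_div_val, coe_tripleToM, coe_tripleToM]
  simp only [Triple.val, mkData, Units.val_one, map_one, one_mul, mul_one, OneMemClass.coe_one]
  ring

/-- Coprimality is not needed, since bimultiplicativity makes common factors cancel. This permits
unreduced fractions in the proof of the product formula. -/
theorem symM_div_div (c c' : kˣ) (a b a' b' : DistPoly k) (u u' : OneUnit k) :
    symM k (tripleToM k (c, a, u) / tripleToM k (1, b, 1))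
      (tripleToM k (c', a', u') / tripleToM k (1, b', 1)) =
    (-1) ^ (((a : (IntegerRing k)[X]).natDegree - (b : (IntegerRing k)[X]).natDegree : ℤ) *
      ((a' : (IntegerRing k)[X]).natDegree - (b' : (IntegerRing k)[X]).natDegree : ℤ)) *
    (c' ^ ((a : (IntegerRing k)[X]).natDegree - (b : (IntegerRing k)[X]).natDegree : ℤ) /
      c ^ ((a' : (IntegerRing k)[X]).natDegree - (b' : (IntegerRing k)[X]).natDegree : ℤ)) *
    (normUnit k a u' / normUnit k a' u) * (normUnit k b' u / normUnit k b u') := by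
  simp only [_root_.map_div, MonoidHom.div_apply, symM_tripleToM, Triple.deg, one_pow, map_one,
    div_one, one_div, OneMemClass.coe_one, mul_one]
  simp only [← zpow_natCast, zpow_sub, sub_mul, mul_sub, Nat.cast_mul]
  simp only [div_eq_mul_inv, mul_inv, inv_inv]
  ext
  push_cast
  ring

/-- `symM` is the symbol of the definition by Weierstrass factorisations. -/
theorem isSymbolM_symM (f g : (FracField k)ˣ) : IsSymbolM f g (symM k f g) := by
  obtain ⟨c, a, b, u, h, rfl⟩ := exists_triple_div f
  obtain ⟨c', a', b', u', h', rfl⟩ := exists_triple_div g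
  refine ⟨mkData c a b u h, mkData c' a' b' u' h', mkData_represents c a b u h,
    mkData_represents c' a' b' u' h', ?_⟩
  rw [symM_div_div, weierstrassSymbol]
  simp only [Units.val_mul, Units.val_div_eq_div_val, Units.val_zpow_eq_zpow_val, map_mul, map_div₀,
    map_zpow₀, algebraMap_normUnit, Units.val_neg, Units.val_one, map_neg, map_one]
  rfl

theorem symM_mul_symM_swap (f g : (FracField k)ˣ) : symM k f g * symM k g f = 1 := by
  have key : ∀ s t, symM k (tripleToM k s) (tripleToM k t) *
      symM k (tripleToM k t) (tripleToM k s) = 1 := by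
    intro s t
    have h : ((-1 : kˣ) ^ (s.deg * t.deg)) * (-1) ^ (s.deg * t.deg) = 1 := by
      rw [← mul_pow]; simp
    rw [symM_tripleToM, symM_tripleToM, mul_comm t.deg, mul_mul_mul_comm,
      mul_mul_mul_comm ((-1 : kˣ) ^ _), h]
    simp
  obtain ⟨s, t, rfl⟩ := isGroupCompletion_tripleToM.exists_div f
  obtain ⟨s', t', rfl⟩ := isGroupCompletion_tripleToM.exists_div g
  have h1 := key s s'
  have h2 := key s t'
  have h3 := key t s'
  have h4 := key t t'
  rw [mul_eq_one_iff_eq_inv] at h1 h2 h3 h4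
  simp only [_root_.map_div, MonoidHom.div_apply, h1, h2, h3, h4]
  ext
  push_cast
  field_simp

theorem symM_eq_inv_swap (f g : (FracField k)ˣ) : symM k f g = (symM k g f)⁻¹ :=
  mul_eq_one_iff_eq_inv.1 (symM_mul_symM_swap f g)

/-- The constant of r is only known to lie in k, so its denominator is cleared before
multiplicativity over 𝒪_k is applied. -/
theorem normRoot_triple {a : (IntegerRing k)[X]} (ha : IsDist a) {r : Triple k} {Y : PowerRing k}
    (hr : r.val = powerToM k Y) :
    (normRoot a Y : k) = (r.1 : k) ^ a.natDegree *
      (normRoot a ((r.2.1 : (IntegerRing k)[X]) : PowerRing k) : k) *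
      (normRoot a ((r.2.2 : (PowerRing k)ˣ) : PowerRing k) : k) := by
  obtain ⟨d, e, he, hde⟩ := IsFractionRing.div_surjective (A := IntegerRing k) (r.1 : k)
  have he0 : e ≠ 0 := nonZeroDivisors.ne_zero he
  have he1 : (e : k) ≠ 0 := by simpa using he0
  change (d : k) / (e : k) = r.1 at hde
  rw [div_eq_iff he1] at hde
  have h1 : PowerSeries.C e * Y = PowerSeries.C d * ((r.2.1 : (IntegerRing k)[X]) : PowerRing k) *
      ((r.2.2 : (PowerRing k)ˣ) : PowerRing k) := by
    apply powerToM_injective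
    rw [map_mul, map_mul, map_mul, ← hr, Triple.val, ← constToM_coe, ← constToM_coe, hde, map_mul]
    ring
  have h2 := congrArg (normRoot a) h1
  rw [normRoot_mul_right ha, normRoot_mul_right ha, normRoot_mul_right ha, normRoot_C ha,
    normRoot_C ha] at h2
  have h3 := congrArg (Subtype.val) h2
  push_cast at h3
  rw [hde, mul_pow] at h3
  apply mul_left_cancel₀ (pow_ne_zero a.natDegree he1)
  rw [h3]
  ring

/-- The relation between the symbol and the two products over roots. -/
theorem symM_mul_normRoot {s r : Triple k} {X Y : PowerRing k} (hs : s.val = powerToM k X)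
    (hr : r.val = powerToM k Y) :
    (symM k (tripleToM k s) (tripleToM k r) : k) * normRoot (r.2.1 : (IntegerRing k)[X]) X =
      normRoot (s.2.1 : (IntegerRing k)[X]) Y := by
  -- The two cross terms between the distinguished polynomials differ by the sign in
  -- `normRoot_comm`, which is the sign of the symbol.
  rw [symM_tripleToM, normRoot_triple (distPoly_isDist _) hs,
    normRoot_triple (distPoly_isDist _) hr, normRoot_comm (distPoly_isDist s.2.1)
    (distPoly_isDist r.2.1)]
  have h1 : (s.1 : k) ≠ 0 := s.1.ne_zero
  have h2 : (normRoot (r.2.1 : (IntegerRing k)[X]) ((s.2.2 : (PowerRing k)ˣ) : PowerRing k) : k) ≠ 0 :=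
    (normUnit k r.2.1 s.2.2).ne_zero
  push_cast
  simp only [coe_normUnit, Triple.deg]
  field_simp

theorem eq_C_mul_of_val_eq {s : Triple k} {x : PowerRing k} (hs : s.val = powerToM k x)
    {c : IntegerRing k} (hc : (s.1 : k) = c) : x = PowerSeries.C c *
      ((s.2.1 : (IntegerRing k)[X]) : PowerRing k) * ((s.2.2 : (PowerRing k)ˣ) : PowerRing k) := by
  apply powerToM_injective
  rw [← hs, Triple.val, hc, constToM_coe, map_mul, map_mul]

theorem exists_integer_triple {x : PowerRing k} (hx : x ≠ 0) :
    ∃ (s : Triple k) (c : IntegerRing k), (s.1 : k) = c ∧ s.val = powerToM k x := by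
  obtain ⟨c, y, hc, rfl, hy⟩ := exists_eq_C_mul hx
  obtain ⟨a, U, rfl⟩ := exists_triple_of_residue_ne_zero hy
  obtain ⟨h0, u, -, h⟩ := exists_triple_C_mul c hc a U
  exact ⟨_, c * PowerSeries.constantCoeff (U : PowerRing k), rfl, h⟩

theorem evalHom_eq_zero_of_val_eq {s : Triple k} {x : PowerRing k} (hs : s.val = powerToM k x)
    {c : IntegerRing k} (hc : (s.1 : k) = c) {a : (IntegerRing k)[X]} (ha : IsDist a)
    {α : AlgebraicClosure k} (hα : a.eval₂ (intToClosure k) α = 0) :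
    evalHom ha hα x = 0 ↔ (s.2.1 : (IntegerRing k)[X]).eval₂ (intToClosure k) α = 0 := by
  rw [eq_C_mul_of_val_eq hs hc, map_mul, map_mul, evalHom_C, evalHom_coe, mul_eq_zero, mul_eq_zero]
  have h1 : evalHom ha hα ((s.2.2 : (PowerRing k)ˣ) : PowerRing k) ≠ 0 :=
    ((s.2.2 : (PowerRing k)ˣ).isUnit.map _).ne_zero
  have h2 : intToClosure k c ≠ 0 := by
    rw [intToClosure_apply, ← hc]
    exact (_root_.map_ne_zero _).2 s.1.ne_zero
  simp [h1, h2]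

/-- Put y = z - x and write N_x, N_y, N_z for products over the roots of the distinguished parts.
Expanding bilinearly gives {x,y}{z,z} / ({x,z}{z,y}), and `symM_mul_normRoot` turns the mixed
symbols into quotients of such products. From y ≡ z mod x, y ≡ -x mod z and x ≡ z mod y they become
N_x(z)/N_y(z), N_x(z)/N_z(x) and ±N_z(x)/N_y(z), which cancel. The absence of common roots keeps the
denominators nonzero. -/
theorem symM_steinberg_aux {s t r : Triple k} {x z : PowerRing k} {c d e : IntegerRing k}
    (hs : s.val = powerToM k x) (hs' : (s.1 : k) = c)
    (ht : t.val = powerToM k z) (ht' : (t.1 : k) = d)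
    (hr : r.val = powerToM k (z - x)) (hr' : (r.1 : k) = e)
    (hab : ∀ α : AlgebraicClosure k, (s.2.1 : (IntegerRing k)[X]).eval₂ (intToClosure k) α = 0 →
      (t.2.1 : (IntegerRing k)[X]).eval₂ (intToClosure k) α ≠ 0) :
    symM k (tripleToM k s / tripleToM k t) (tripleToM k r / tripleToM k t) = 1 := by
  have dvd : ∀ {s : Triple k} {x : PowerRing k} {c : IntegerRing k}, s.val = powerToM k x →
      (s.1 : k) = c → ((s.2.1 : (IntegerRing k)[X]) : PowerRing k) ∣ x := by
    intro s x c hs hc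
    refine ⟨PowerSeries.C c * ((s.2.2 : (PowerRing k)ˣ) : PowerRing k), ?_⟩
    rw [eq_C_mul_of_val_eq hs hc]
    ring
  have ha := distPoly_isDist s.2.1
  have hb := distPoly_isDist t.2.1
  have hc := distPoly_isDist r.2.1
  have e1 := symM_mul_normRoot hs hr
  have e2 := symM_mul_normRoot hs ht
  have e3 := symM_mul_normRoot ht hr
  have a1 : normRoot (s.2.1 : (IntegerRing k)[X]) (z - x) = normRoot (s.2.1 : (IntegerRing k)[X]) z :=
    normRoot_eq_of_dvd_sub ha (by simpa using dvd hs hs')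
  have a2 : normRoot (t.2.1 : (IntegerRing k)[X]) (z - x) =
      (-1) ^ t.deg * normRoot (t.2.1 : (IntegerRing k)[X]) x := by
    rw [normRoot_eq_of_dvd_sub hb (u := z - x) (v := PowerSeries.C (-1) * x)
      (by simpa using dvd ht ht'), normRoot_mul_right hb, normRoot_C hb, Triple.deg]
  have a3 : normRoot (r.2.1 : (IntegerRing k)[X]) x = normRoot (r.2.1 : (IntegerRing k)[X]) z :=
    (normRoot_eq_of_dvd_sub hc (dvd hr hr')).symm
  have n1 : normRoot (s.2.1 : (IntegerRing k)[X]) z ≠ 0 := by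
    intro h0
    obtain ⟨α, hα, h1⟩ := normRoot_eq_zero ha h0
    exact hab α hα ((evalHom_eq_zero_of_val_eq ht ht' ha hα).1 h1)
  have n2 : normRoot (t.2.1 : (IntegerRing k)[X]) x ≠ 0 := by
    intro h0
    obtain ⟨α, hα, h1⟩ := normRoot_eq_zero hb h0
    exact hab α ((evalHom_eq_zero_of_val_eq hs hs' hb hα).1 h1) hα
  have n3 : normRoot (r.2.1 : (IntegerRing k)[X]) z ≠ 0 := by
    intro h0
    obtain ⟨α, hα, h1⟩ := normRoot_eq_zero hc h0
    have h2 := (evalHom_eq_zero_of_val_eq hr hr' hc hα).2 hα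
    rw [map_sub, h1, zero_sub, neg_eq_zero] at h2
    exact hab α ((evalHom_eq_zero_of_val_eq hs hs' hc hα).1 h2)
      ((evalHom_eq_zero_of_val_eq ht ht' hc hα).1 h1)
  -- The exponent d² has the parity of d; this sign cancels the one coming from y ≡ -x mod z.
  have htt : symM k (tripleToM k t) (tripleToM k t) = (-1) ^ t.deg := by
    rw [symM_tripleToM, div_self', div_self', mul_one, mul_one]
    rcases Nat.even_or_odd t.deg with h | h
    · rw [h.neg_one_pow, (h.mul_left _).neg_one_pow]
    · rw [h.neg_one_pow, (h.mul h).neg_one_pow]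
  rw [_root_.map_div, _root_.map_div, MonoidHom.div_apply, MonoidHom.div_apply, htt]
  rw [a1, a3] at e1
  rw [a2] at e3
  have n1' : (normRoot (s.2.1 : (IntegerRing k)[X]) z : k) ≠ 0 := by simpa using n1
  have n2' : (normRoot (t.2.1 : (IntegerRing k)[X]) x : k) ≠ 0 := by simpa using n2
  have n3' : (normRoot (r.2.1 : (IntegerRing k)[X]) z : k) ≠ 0 := by simpa using n3
  push_cast at e3
  ext
  push_cast
  rw [eq_div_of_mul_eq n3' e1, eq_div_of_mul_eq n2' e2, eq_div_of_mul_eq n3' e3]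
  field_simp

/-- The Steinberg relation for the symbol on `M`. -/
theorem symM_steinberg {f g : (FracField k)ˣ} (hfg : (f : FracField k) + g = 1) :
    symM k f g = 1 := by
  obtain ⟨c, a, b, u, hrel, rfl⟩ := exists_triple_div f
  -- Distributing the constant as d/e over numerator and denominator makes both of them integral
  -- power series.
  obtain ⟨d, e, he, hde⟩ := IsFractionRing.div_surjective (A := IntegerRing k) (c : k)
  have he0 : e ≠ 0 := nonZeroDivisors.ne_zero he
  have he1 : (e : k) ≠ 0 := by simpa using he0
  change (d : k) / (e : k) = c at hde
  have hd0 : d ≠ 0 := by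
    rintro rfl
    exact c.ne_zero (by rw [← hde]; simp)
  let s : Triple k := (intUnit d hd0, a, u)
  let t : Triple k := (intUnit e he0, b, 1)
  let x : PowerRing k := PowerSeries.C d * ((a : (IntegerRing k)[X]) : PowerRing k) *
    ((u : (PowerRing k)ˣ) : PowerRing k)
  let z : PowerRing k := PowerSeries.C e * ((b : (IntegerRing k)[X]) : PowerRing k) *
    (((1 : OneUnit k) : (PowerRing k)ˣ) : PowerRing k)
  have hs : s.val = powerToM k x := by
    simp only [s, x, Triple.val, coe_intUnit, constToM_coe, map_mul]
  have ht : t.val = powerToM k z := by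
    simp only [t, z, Triple.val, coe_intUnit, constToM_coe, map_mul]
  have hf : tripleToM k (c, a, u) / tripleToM k (1, b, 1) = tripleToM k s / tripleToM k t := by
    rw [div_eq_div_iff_mul_eq_mul, ← map_mul, ← map_mul]
    congr 1
    refine Prod.ext (Units.ext ?_) (Prod.ext rfl rfl)
    simp [s, t, ← hde, div_mul_cancel₀ _ he1]
  rw [hf] at hfg ⊢
  have hz : powerToM k z ≠ 0 := ht ▸ t.val_ne_zero
  have hg : (g : FracField k) * powerToM k z = powerToM k (z - x) := by
    rw [Units.val_div_eq_div_val, coe_tripleToM, coe_tripleToM, hs, ht] at hfg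
    field_simp at hfg
    rw [map_sub]
    linear_combination hfg
  have hY : z - x ≠ 0 := by
    intro h0
    rw [h0, map_zero] at hg
    exact mul_ne_zero g.ne_zero hz hg
  obtain ⟨r, e', hr', hr⟩ := exists_integer_triple hY
  have hg' : g = tripleToM k r / tripleToM k t := by
    rw [eq_div_iff_mul_eq']
    ext
    rw [Units.val_mul, coe_tripleToM, coe_tripleToM, hr, ht, ← hg]
  rw [hg']
  exact symM_steinberg_aux hs rfl ht rfl hr hr' fun α h1 =>
    no_common_root (distPoly_isDist a).monic hrel h1

end SymbolOnM

/-! ### Continuity of the symbol on M -/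

section Filtration
open Polynomial

variable {k : Type*} [NontriviallyNormedField k] [IsUltrametricDist k] [ProperSpace k]

theorem valM_powerToM (x : PowerRing k) : valM k (powerToM k x) = gauss x :=
  Valuation.extendToLocalization_apply_map_apply (gaussValuation k) nonZeroDivisors_le
    (FracField k) x

theorem gauss_C (c : IntegerRing k) : gauss (PowerSeries.C c) = ‖(c : k)‖₊ := by
  apply le_antisymm
  · refine ciSup_le fun n => ?_
    rw [PowerSeries.coeff_C]
    split_ifs <;> simp
  · simpa using coeff_le_gauss (PowerSeries.C c) 0

theorem gauss_le_one (x : PowerRing k) : gauss x ≤ 1 := ciSup_le fun n => (x.coeff n).2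

theorem valM_constToM (c : k) : valM k (constToM k c) = ‖c‖₊ := by
  obtain ⟨d, e, he, hde⟩ := IsFractionRing.div_surjective (A := IntegerRing k) c
  change (d : k) / (e : k) = c at hde
  rw [← hde, map_div₀, map_div₀, constToM_coe, constToM_coe, valM_powerToM, valM_powerToM, gauss_C,
    gauss_C, nnnorm_div]

theorem C_dvd_of_gauss_le {c : IntegerRing k} (hc : c ≠ 0) {x : PowerRing k}
    (h : gauss x ≤ ‖(c : k)‖₊) : PowerSeries.C c ∣ x := by
  have hd : ∀ m, c ∣ x.coeff m := fun m =>
    (integer_dvd_iff hc).2 (by exact_mod_cast (coeff_le_gauss x m).trans h)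
  choose q hq using hd
  refine ⟨PowerSeries.mk q, ?_⟩
  ext m
  rw [PowerSeries.coeff_C_mul, PowerSeries.coeff_mk, ← hq]

/-- Write the denominator as c z with z nonzero in the residue field. Multiplicativity of the Gauss
norm shows that numerator minus denominator is divisible by p c, and c cancels. -/
theorem exists_eq_div_of_valM_sub_one_le {f : (FracField k)ˣ} {p : IntegerRing k} (hp : p ≠ 0)
    (hf : valM k ((f : FracField k) - 1) ≤ ‖(p : k)‖₊) :
    ∃ z h : PowerRing k, z.map (IsLocalRing.residue (IntegerRing k)) ≠ 0 ∧
      (f : FracField k) * powerToM k z = powerToM k (z + PowerSeries.C p * h) := by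
  obtain ⟨x, z, hz, hxz⟩ := IsFractionRing.div_surjective (A := PowerRing k) (f : FracField k)
  obtain ⟨c, z, hc, rfl, hz'⟩ := exists_eq_C_mul (nonZeroDivisors.ne_zero hz)
  change powerToM k x / powerToM k _ = _ at hxz
  have hz0 : powerToM k (PowerSeries.C c * z) ≠ 0 :=
    (map_ne_zero_iff _ powerToM_injective).2 (nonZeroDivisors.ne_zero hz)
  have hc0 : powerToM k (PowerSeries.C c) ≠ 0 := by
    rw [map_mul] at hz0
    exact left_ne_zero_of_mul hz0
  have h1 : ((f : FracField k) - 1) * powerToM k (PowerSeries.C c * z) =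
      powerToM k (x - PowerSeries.C c * z) := by
    rw [← hxz, map_sub]
    field_simp
  have h2 := congrArg (valM k) h1
  rw [map_mul, valM_powerToM, valM_powerToM, gauss_mul, gauss_C] at h2
  have h3 : gauss (x - PowerSeries.C c * z) ≤ ‖((p * c : IntegerRing k) : k)‖₊ := by
    rw [← h2]
    push_cast
    rw [nnnorm_mul]
    exact mul_le_mul' hf (mul_le_of_le_one_right' (gauss_le_one z))
  obtain ⟨h, hh⟩ := C_dvd_of_gauss_le (mul_ne_zero hp hc) h3
  refine ⟨z, h, hz', ?_⟩
  apply mul_left_cancel₀ hc0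
  rw [← map_mul]
  have h4 : PowerSeries.C c * (z + PowerSeries.C p * h) = x := by
    rw [map_mul] at hh
    linear_combination -hh
  rw [h4, mul_left_comm, ← map_mul, ← hxz, div_mul_cancel₀ _ hz0]

/-- Weierstrass preparation is compatible with reduction modulo constants. -/
theorem weierstrass_congr {a b : (IntegerRing k)[X]} (ha : IsDist a) (hb : IsDist b)
    (hd : a.natDegree = b.natDegree) {U W : (PowerRing k)ˣ} {p : IntegerRing k} {h : PowerRing k}
    (he : (a : PowerRing k) * U = b * W + PowerSeries.C p * h) :
    (∃ r, a = b + C p * r) ∧ ∃ q : PowerRing k, (U : PowerRing k) = W + PowerSeries.C p * q := by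
  have h1 := ha.eq_mul_add (h * (W⁻¹ : (PowerRing k)ˣ))
  set q := (h * (W⁻¹ : (PowerRing k)ˣ)).weierstrassDiv (a : PowerRing k)
  set r := (h * (W⁻¹ : (PowerRing k)ˣ)).weierstrassMod (a : PowerRing k)
  have hr : r.degree < a.natDegree := ha.weierstrassMod_degree_lt _
  have hWW : (W : PowerRing k) * (W⁻¹ : (PowerRing k)ˣ) = 1 := W.mul_inv
  have hdeg : a.degree = b.degree := by
    rw [degree_eq_natDegree ha.monic.ne_zero, degree_eq_natDegree hb.monic.ne_zero, hd]
  have h2 : (b + C p * r - a).degree < a.natDegree := by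
    rw [add_sub_right_comm]
    refine (degree_add_le _ _).trans_lt (max_lt ?_ ?_)
    · rw [← degree_eq_natDegree ha.monic.ne_zero, hdeg]
      exact degree_sub_lt_left hdeg.symm hb.monic.ne_zero (by rw [ha.monic, hb.monic])
    · rw [C_mul']
      exact (degree_smul_le _ _).trans_lt hr
  -- Multiplying the hypothesis by W⁻¹ and dividing h W⁻¹ by a exhibits two divisions of one series
  -- by a; their quotients and remainders give both congruences at once.
  have h3 : (a : PowerRing k) * 1 + ((b + C p * r - a : (IntegerRing k)[X]) : PowerRing k) =
      a * (U * (W⁻¹ : (PowerRing k)ˣ) - PowerSeries.C p * q) + ((0 : (IntegerRing k)[X]) : PowerRing k) := by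
    push_cast
    linear_combination (-(W⁻¹ : (PowerRing k)ˣ) : PowerRing k) * he - (b : PowerRing k) * hWW
      - PowerSeries.C p * h1
  obtain ⟨h4, h5⟩ := ha.division_unique h2 (by rw [degree_zero]; exact WithBot.bot_lt_coe _) h3
  refine ⟨⟨r, by linear_combination -h5⟩, W * q, ?_⟩
  linear_combination (-(W : PowerRing k)) * h4 - (U : PowerRing k) * hWW

/-- Uniqueness of division shows that the remainders of u by a and of v by b are congruent modulo p.
Resultants with fixed formal degrees commute with reduction modulo p. -/
theorem normRoot_congr {a b : (IntegerRing k)[X]} (ha : IsDist a) (hb : IsDist b)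
    (hd : a.natDegree = b.natDegree) {p : IntegerRing k} {r : (IntegerRing k)[X]}
    (hab : a = b + C p * r) {u v q : PowerRing k} (huv : u = v + PowerSeries.C p * q) :
    p ∣ normRoot a u - normRoot b v := by
  have h1 := ha.eq_mul_add u
  have h2 := hb.eq_mul_add v
  set q0 := u.weierstrassDiv (a : PowerRing k) with hq0
  have h3 := hb.eq_mul_add ((r : PowerRing k) * q0 - q)
  have d1 := ha.weierstrassMod_degree_lt u
  have d2 := hb.weierstrassMod_degree_lt v
  have d3 := hb.weierstrassMod_degree_lt ((r : PowerRing k) * q0 - q)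
  set r0 := u.weierstrassMod (a : PowerRing k) with hr0
  set r1 := v.weierstrassMod (b : PowerRing k) with hr1
  set r2 := ((r : PowerRing k) * q0 - q).weierstrassMod (b : PowerRing k)
  set q1 := v.weierstrassDiv (b : PowerRing k)
  set q2 := ((r : PowerRing k) * q0 - q).weierstrassDiv (b : PowerRing k)
  have habs : (a : PowerRing k) = b + PowerSeries.C p * r := by
    rw [hab]; push_cast; rfl
  have d4 : (r0 + C p * r2).degree < b.natDegree := by
    refine (degree_add_le _ _).trans_lt (max_lt (by rwa [← hd]) ?_)
    rw [C_mul']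
    exact (degree_smul_le _ _).trans_lt d3
  have h4 : (b : PowerRing k) * q1 + r1 =
      b * (q0 + PowerSeries.C p * q2) + ((r0 + C p * r2 : (IntegerRing k)[X]) : PowerRing k) := by
    push_cast
    linear_combination h1 - h2 - huv + PowerSeries.C p * h3 + q0 * habs
  have h5 := (hb.division_unique d2 d4 h4).2
  have hmr : r1.map (Ideal.Quotient.mk (Ideal.span {p})) =
      r0.map (Ideal.Quotient.mk (Ideal.span {p})) := by
    rw [h5, Polynomial.map_add, Polynomial.map_mul, Polynomial.map_C,
      Ideal.Quotient.eq_zero_iff_mem.2 (Ideal.mem_span_singleton_self p), C_0, zero_mul, add_zero]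
  have hma : a.map (Ideal.Quotient.mk (Ideal.span {p})) =
      b.map (Ideal.Quotient.mk (Ideal.span {p})) := by
    rw [hab, Polynomial.map_add, Polynomial.map_mul, Polynomial.map_C,
      Ideal.Quotient.eq_zero_iff_mem.2 (Ideal.mem_span_singleton_self p), C_0, zero_mul, add_zero]
  rw [← Ideal.mem_span_singleton, ← Ideal.Quotient.mk_eq_mk_iff_sub_mem, normRoot, normRoot,
    ← resultant_map_map, ← resultant_map_map, hd, ← hr0, ← hr1, hmr, hma]

/-- The values are units of 𝒪_k, so the additive congruence of `normRoot_congr` is a multiplicative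
one. -/
theorem normUnit_div_normUnit_mem {a b : DistPoly k}
    (hd : (a : (IntegerRing k)[X]).natDegree = (b : (IntegerRing k)[X]).natDegree) {i : ℕ+}
    {r : (IntegerRing k)[X]} (hab : (a : (IntegerRing k)[X]) = b + C (unif k ^ (i : ℕ)) * r)
    {u v : (PowerRing k)ˣ} {q : PowerRing k}
    (huv : (u : PowerRing k) = v + PowerSeries.C (unif k ^ (i : ℕ)) * q) :
    normUnit k a u / normUnit k b v ∈ unitFil k i := by
  have h := normRoot_congr (distPoly_isDist a) (distPoly_isDist b) hd hab huv
  rw [unif_pow_dvd_iff] at h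
  push_cast at h
  have h1 : ‖(normUnit k b v : k)‖ = 1 := by
    rw [coe_normUnit, ← integer_isUnit_iff]
    exact v.isUnit.map (normRootHom b)
  rw [mem_unitFil, Units.val_div_eq_div_val, div_sub_one (normUnit k b v).ne_zero, norm_div, h1,
    div_one]
  exact h

theorem normUnit_eq {a : DistPoly k} {U : (PowerRing k)ˣ} {u : OneUnit k} {c : kˣ}
    (hc : (c : k) = PowerSeries.constantCoeff (U : PowerRing k))
    (h : (U : PowerRing k) = PowerSeries.C (PowerSeries.constantCoeff (U : PowerRing k)) *
        ((u : (PowerRing k)ˣ) : PowerRing k)) :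
    normUnit k a U = c ^ (a : (IntegerRing k)[X]).natDegree * normUnit k a u := by
  ext
  rw [Units.val_mul, coe_normUnit, h, normRoot_mul_right (distPoly_isDist a),
    normRoot_C (distPoly_isDist a)]
  push_cast
  rw [hc]
  rfl

/-- The symbol on `M` respects the filtration by higher units. -/
theorem symM_mem_unitFil {i : ℕ+} {f : (FracField k)ˣ}
    (hf : valM k ((f : FracField k) - 1) ≤ ‖(unif k : k)‖₊ ^ (i : ℕ)) (g : (FracField k)ˣ) :
    symM k f g ∈ unitFil k i := by
  obtain ⟨z, h, hz, hfz⟩ := exists_eq_div_of_valM_sub_one_le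
    (pow_ne_zero (i : ℕ) (unif_ne_zero (k := k))) (by simpa using hf)
  have hres : (z + PowerSeries.C (unif k ^ (i : ℕ)) * h).map (IsLocalRing.residue (IntegerRing k)) =
      z.map (IsLocalRing.residue (IntegerRing k)) := by
    have : IsLocalRing.residue (IntegerRing k) (unif k) = 0 := by
      rw [IsLocalRing.residue_eq_zero_iff, maximalIdeal_eq_span]
      exact Ideal.mem_span_singleton_self _
    rw [map_add, map_mul, PowerSeries.map_C, map_pow, this, zero_pow i.ne_zero, map_zero, zero_mul,
      add_zero]
  obtain ⟨a, U, hx⟩ := exists_triple_of_residue_ne_zero (hres ▸ hz)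
  obtain ⟨b, W, rfl⟩ := exists_triple_of_residue_ne_zero hz
  have hnot : ∀ U : (PowerRing k)ˣ, PowerSeries.constantCoeff (U : PowerRing k) ∉
      IsLocalRing.maximalIdeal (IntegerRing k) := fun U h =>
    (IsLocalRing.mem_maximalIdeal _).1 h (PowerSeries.isUnit_iff_constantCoeff.1 U.isUnit)
  -- Both degrees are the order of the same reduction modulo the maximal ideal.
  have hd : (a : (IntegerRing k)[X]).natDegree = (b : (IntegerRing k)[X]).natDegree := by
    have h1 := (distPoly_isDist a).coe_natDegree_eq_order_map _ _ (hnot U) hx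
    have h2 := (distPoly_isDist b).coe_natDegree_eq_order_map _ _ (hnot W) rfl
    have h3 := h1.trans ((congrArg PowerSeries.order hres).trans h2.symm)
    exact_mod_cast h3
  obtain ⟨⟨r, hr⟩, q, hq⟩ := weierstrass_congr (distPoly_isDist a) (distPoly_isDist b) hd hx.symm
  obtain ⟨hU0, u, hu, hsu⟩ := exists_triple_C_mul 1 one_ne_zero a U
  obtain ⟨hW0, w, hw, htw⟩ := exists_triple_C_mul 1 one_ne_zero b W
  rw [map_one, one_mul (((a : (IntegerRing k)[X]) : PowerRing k) * U)] at hsu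
  rw [map_one, one_mul (((b : (IntegerRing k)[X]) : PowerRing k) * W)] at htw
  set s : Triple k := (intUnit _ hU0, a, u) with hs
  set t : Triple k := (intUnit _ hW0, b, w) with ht
  have hfst : f = tripleToM k s / tripleToM k t := by
    rw [eq_div_iff_mul_eq']
    ext
    rw [Units.val_mul, coe_tripleToM, coe_tripleToM, hsu, htw, ← hx, ← hfz]
  -- With equal degrees the signs and the powers of the constant of y cancel. The constants of U and
  -- W are absorbed by taking root products of the full units, leaving two quotients of congruent
  -- units.
  have key : ∀ y : Triple k, symM k f (tripleToM k y) ∈ unitFil k i := by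
    intro y
    have h1 : symM k f (tripleToM k y) = normUnit k a y.2.2 / normUnit k b y.2.2 *
        (normUnit k y.2.1 U / normUnit k y.2.1 W)⁻¹ := by
      rw [hfst, _root_.map_div, MonoidHom.div_apply, symM_tripleToM, symM_tripleToM,
        normUnit_eq (c := intUnit _ hU0) (by simp) hu, normUnit_eq (c := intUnit _ hW0) (by simp) hw]
      simp only [Triple.deg, hs, ht, hd]
      ext
      push_cast
      field_simp
    rw [h1]
    exact mul_mem (normUnit_div_normUnit_mem (q := 0) hd hr (by simp))
      (inv_mem (normUnit_div_normUnit_mem (r := 0) rfl (by simp) hq))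
  obtain ⟨y, y', rfl⟩ := isGroupCompletion_tripleToM.exists_div g
  rw [_root_.map_div]
  exact div_mem (key y) (key y')

end Filtration

/-! ### Density of M in L and the symbol on L modulo U^i -/

section ValuationL

variable {k : Type*} [NontriviallyNormedField k] [IsUltrametricDist k] [ProperSpace k]

theorem valL_mToL (f : FracField k) : valL k (mToL k f) = valM k f :=
  Valued.valuedCompletion_apply (WithVal.toVal (valM k) f)

theorem setOf_valL_sub_lt_mem_nhds (x : StdField k) {y : StdField k} (hy : y ≠ 0) :
    {z | valL k (z - x) < valL k y} ∈ 𝓝 x := by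
  refine (Valued.mem_nhds (R := StdField k) (Γ₀ := ℝ≥0)).2 ⟨Units.mk0 ((Valued.v : Valuation (StdField k) ℝ≥0).restrict y)
    ((Valuation.ne_zero_iff _).2 hy), fun z hz => ?_⟩
  exact (Valuation.restrict_lt_iff _).1 hz

theorem exists_valL_sub_lt (x : StdField k) {y : StdField k} (hy : y ≠ 0) :
    ∃ f : FracField k, valL k (mToL k f - x) < valL k y := by
  obtain ⟨z, hz, f, rfl⟩ := (mem_closure_iff_nhds.1
    (UniformSpace.Completion.denseRange_coe (α := WithVal (valM k)) x)) _
    (setOf_valL_sub_lt_mem_nhds x hy)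
  exact ⟨f.ofVal, hz⟩

theorem exists_valL_eq (x : StdField k) : ∃ f : FracField k, valL k x = valM k f := by
  obtain ⟨r, hr⟩ := Valued.exists_coe_eq_v x
  exact ⟨r.ofVal, hr⟩

/-- The Gauss norm of a series is attained by a coefficient. So M and L have the value group of k,
and a uniformizer of k is one for L. -/
theorem exists_valM_eq (f : FracField k) : ∃ c : k, valM k f = ‖c‖₊ := by
  obtain ⟨x, z, -, rfl⟩ := IsFractionRing.div_surjective (A := PowerRing k) f
  obtain ⟨m, hm⟩ := exists_coeff_eq_gauss x
  obtain ⟨n, hn⟩ := exists_coeff_eq_gauss z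
  refine ⟨x.coeff m / z.coeff n, ?_⟩
  rw [map_div₀, nnnorm_div, hm, hn, ← valM_powerToM, ← valM_powerToM]
  rfl

variable (k) in
/-- The chosen uniformizer of `k` as an element of `L`. -/
def unifL : StdField k := mToL k (constToM k (unif k))

theorem valL_unifL : valL k (unifL k) = ‖(unif k : k)‖₊ := by
  rw [unifL, valL_mToL, valM_constToM]

theorem isUnif_unifL : IsUnif (valL k) (unifL k) where
  ne_zero := by
    rw [← Valuation.ne_zero_iff (valL k), valL_unifL]
    simpa using unif_ne_zero (k := k)
  lt_one := by
    rw [valL_unifL]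
    exact norm_unif_lt_one (k := k)
  le_of_lt x hx := by
    obtain ⟨f, hf⟩ := exists_valL_eq x
    obtain ⟨c, hc⟩ := exists_valM_eq f
    rw [valL_unifL, hf, hc]
    rw [hf, hc] at hx
    exact norm_le_unif hx

variable (k) in
/-- The subgroup `U^i` of `Lˣ`. -/
def unitFilL (i : ℕ+) : Subgroup (StdField k)ˣ :=
  unitBall (valL k) _ ((isUnif_unifL (k := k)).pow_lt_one i)

theorem mem_unitFilL {i : ℕ+} {u : (StdField k)ˣ} :
    u ∈ unitFilL k i ↔ valL k ((u : StdField k) - 1) ≤ ‖(unif k : k)‖₊ ^ (i : ℕ) := by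
  rw [← valL_unifL]
  rfl

theorem mem_higherUnits_valL_iff {i : ℕ+} {u : (StdField k)ˣ} :
    u ∈ higherUnits (valL k) i ↔ u ∈ unitFilL k i :=
  isUnif_unifL.mem_higherUnits

variable (k) in
/-- The embedding `Mˣ → Lˣ`. -/
def unitsMToL : (FracField k)ˣ →* (StdField k)ˣ := Units.map (mToL k)

theorem div_mem_unitFilL {i : ℕ+} {f g : (StdField k)ˣ}
    (h : valL k ((g : StdField k) - f) ≤ ‖(unif k : k)‖₊ ^ (i : ℕ) * valL k (f : StdField k)) :
    g / f ∈ unitFilL k i := by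
  have hf : valL k (f : StdField k) ≠ 0 := (Valuation.ne_zero_iff _).2 f.ne_zero
  rw [mem_unitFilL, Units.val_div_eq_div_val, div_sub_one f.ne_zero, map_div₀]
  exact (div_le_iff₀ (pos_iff_ne_zero.2 hf)).2 h

/-- The second, absolute bound by y is for the Steinberg relation, where 1 - f must be approximated
along with f. -/
theorem exists_unitsMToL_div_mem (i : ℕ+) (f : (StdField k)ˣ) {y : StdField k} (hy : y ≠ 0) :
    ∃ m : (FracField k)ˣ, unitsMToL k m / f ∈ unitFilL k i ∧
      valL k (mToL k m - f) < valL k y := by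
  obtain ⟨m, hm⟩ := exists_valL_sub_lt (f : StdField k)
    (y := if valL k y ≤ valL k (unifL k ^ (i : ℕ) * f) then y else unifL k ^ (i : ℕ) * f)
    (by split_ifs
        · exact hy
        · exact mul_ne_zero (pow_ne_zero _ isUnif_unifL.ne_zero) f.ne_zero)
  have h1 : valL k (mToL k m - f) < valL k y := by
    split_ifs at hm with h
    · exact hm
    · exact hm.trans (not_le.1 h)
  have h2 : valL k (mToL k m - f) < valL k (unifL k ^ (i : ℕ) * f) := by
    split_ifs at hm with h
    · exact hm.trans_le h
    · exact hm
  rw [map_mul, map_pow, valL_unifL] at h2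
  have hm0 : m ≠ 0 := by
    rintro rfl
    rw [map_zero, zero_sub, Valuation.map_neg] at h2
    refine absurd h2 (not_lt.2 (mul_le_of_le_one_left' (pow_le_one₀ zero_le ?_)))
    exact (norm_unif_lt_one (k := k)).le
  exact ⟨Units.mk0 m hm0, div_mem_unitFilL h2.le, h1⟩

theorem unitsMToL_mem_iff {i : ℕ+} {m : (FracField k)ˣ} :
    unitsMToL k m ∈ unitFilL k i ↔
      valM k ((m : FracField k) - 1) ≤ ‖(unif k : k)‖₊ ^ (i : ℕ) := by
  rw [mem_unitFilL, ← valL_mToL, map_sub (mToL k), map_one (mToL k)]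
  rfl

theorem symM_mem_of_left {i : ℕ+} {m : (FracField k)ˣ} (hm : unitsMToL k m ∈ unitFilL k i)
    (n : (FracField k)ˣ) : symM k m n ∈ unitFil k i :=
  symM_mem_unitFil (unitsMToL_mem_iff.1 hm) n

theorem symM_mem_of_right {i : ℕ+} {m : (FracField k)ˣ} (hm : unitsMToL k m ∈ unitFilL k i)
    (n : (FracField k)ˣ) : symM k n m ∈ unitFil k i := by
  rw [symM_eq_inv_swap]
  exact inv_mem (symM_mem_of_left hm n)

/-- An element of `Mˣ` approximating a given element of `Lˣ`. -/
def approx (i : ℕ+) (f : (StdField k)ˣ) : (FracField k)ˣ :=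
  (exists_unitsMToL_div_mem i f one_ne_zero).choose

theorem approx_spec (i : ℕ+) (f : (StdField k)ˣ) :
    unitsMToL k (approx i f) / f ∈ unitFilL k i :=
  (exists_unitsMToL_div_mem i f one_ne_zero).choose_spec.1

theorem symM_div_symM_mem {i : ℕ+} {m m' n n' : (FracField k)ˣ}
    (hm : unitsMToL k (m / m') ∈ unitFilL k i) (hn : unitsMToL k (n / n') ∈ unitFilL k i) :
    symM k m n / symM k m' n' ∈ unitFil k i := by
  have : symM k m n / symM k m' n' = symM k (m / m') n * symM k m' (n / n') := by
    rw [map_div, map_div, MonoidHom.div_apply, div_mul_div_cancel]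
  rw [this]
  exact mul_mem (symM_mem_of_left hm n) (symM_mem_of_right hn m')

theorem unitsMToL_div_mem {i : ℕ+} {m m' : (FracField k)ˣ} {f : (StdField k)ˣ}
    (h : unitsMToL k m / f ∈ unitFilL k i) (h' : unitsMToL k m' / f ∈ unitFilL k i) :
    unitsMToL k (m / m') ∈ unitFilL k i := by
  have := div_mem h h'
  rwa [div_div_div_cancel_right, ← map_div] at this

variable (k) in
/-- The group `kˣ / U^i`. -/
def UnitsMod (i : ℕ+) : Type _ := kˣ ⧸ unitFil k i

instance (i : ℕ+) : CommGroup (UnitsMod k i) := QuotientGroup.Quotient.commGroup (unitFil k i)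

variable (k) in
/-- The projection `kˣ → kˣ / U^i`. -/
def unitsMk (i : ℕ+) : kˣ →* UnitsMod k i := QuotientGroup.mk' (unitFil k i)

theorem unitsMk_surjective (i : ℕ+) : Function.Surjective (unitsMk k i) :=
  QuotientGroup.mk'_surjective _

theorem unitsMk_eq_iff {i : ℕ+} {x y : kˣ} :
    unitsMk k i x = unitsMk k i y ↔ x / y ∈ unitFil k i :=
  QuotientGroup.eq_iff_div_mem

theorem unitsMk_eq_one_iff {i : ℕ+} {x : kˣ} : unitsMk k i x = 1 ↔ x ∈ unitFil k i := by
  rw [← map_one (unitsMk k i), unitsMk_eq_iff, div_one]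

/-- By continuity on M the class does not depend on the chosen approximations, so products of
approximations may be used; this yields bimultiplicativity on L. -/
theorem mk_symM_approx {i : ℕ+} {f g : (StdField k)ˣ} {m n : (FracField k)ˣ}
    (hm : unitsMToL k m / f ∈ unitFilL k i) (hn : unitsMToL k n / g ∈ unitFilL k i) :
    unitsMk k i (symM k (approx i f) (approx i g)) = unitsMk k i (symM k m n) := by
  rw [unitsMk_eq_iff]
  exact symM_div_symM_mem (unitsMToL_div_mem (approx_spec i f) hm)
    (unitsMToL_div_mem (approx_spec i g) hn)

theorem unitsMToL_mul_div_mem {i : ℕ+} {m m' : (FracField k)ˣ} {f f' : (StdField k)ˣ}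
    (h : unitsMToL k m / f ∈ unitFilL k i) (h' : unitsMToL k m' / f' ∈ unitFilL k i) :
    unitsMToL k (m * m') / (f * f') ∈ unitFilL k i := by
  have e : unitsMToL k m * unitsMToL k m' / (f * f') =
      unitsMToL k m / f * (unitsMToL k m' / f') :=
    mul_div_mul_comm (unitsMToL k m) (unitsMToL k m') f f'
  rw [map_mul, e]
  exact mul_mem h h'

variable (k) in
/-- The symbol on `L` modulo `U^i`. -/
def symLMod (i : ℕ+) : (StdField k)ˣ →* (StdField k)ˣ →* UnitsMod k i :=
  MonoidHom.mk' (fun f => MonoidHom.mk'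
    (fun g => unitsMk k i (symM k (approx i f) (approx i g)))
    (fun g g' => by
      rw [mk_symM_approx (approx_spec i f)
        (unitsMToL_mul_div_mem (approx_spec i g) (approx_spec i g')), map_mul, map_mul]))
    (fun f f' => by
      ext g
      simp only [MonoidHom.mk'_apply, MonoidHom.mul_apply]
      rw [mk_symM_approx (unitsMToL_mul_div_mem (approx_spec i f) (approx_spec i f'))
        (approx_spec i g), map_mul, MonoidHom.mul_apply, map_mul])

theorem symLMod_eq {i : ℕ+} {f g : (StdField k)ˣ} {m n : (FracField k)ˣ}
    (hm : unitsMToL k m / f ∈ unitFilL k i) (hn : unitsMToL k n / g ∈ unitFilL k i) :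
    symLMod k i f g = unitsMk k i (symM k m n) := mk_symM_approx hm hn

theorem symLMod_unitsMToL (i : ℕ+) (m n : (FracField k)ˣ) :
    symLMod k i (unitsMToL k m) (unitsMToL k n) = unitsMk k i (symM k m n) :=
  symLMod_eq (by rw [div_self']; exact one_mem _) (by rw [div_self']; exact one_mem _)

/-- Choose m in M so close to f that 1 - m is close to g relative to the size of g. The pair m, 1 -
m then computes the symbol, and the relation holds in M. -/
theorem symLMod_steinberg (i : ℕ+) {f g : (StdField k)ˣ} (h : (f : StdField k) + g = 1) :
    symLMod k i f g = 1 := by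
  obtain ⟨m, hm, hmg⟩ := exists_unitsMToL_div_mem i f
    (y := unifL k ^ (i : ℕ) * g) (mul_ne_zero (pow_ne_zero _ isUnif_unifL.ne_zero) g.ne_zero)
  have hg : (g : StdField k) = 1 - f := by rw [← h]; ring
  have h1 : mToL k (1 - m) - g = -(mToL k m - f) := by
    rw [hg, map_sub, map_one]; ring
  have h2 : valL k (mToL k (1 - m) - g) < ‖(unif k : k)‖₊ ^ (i : ℕ) * valL k (g : StdField k) := by
    rw [h1, Valuation.map_neg]
    simpa [valL_unifL] using hmg
  have hm0 : (1 - m : FracField k) ≠ 0 := by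
    intro h0
    rw [h0, map_zero, zero_sub, Valuation.map_neg] at h2
    refine absurd h2 (not_lt.2 (mul_le_of_le_one_left' (pow_le_one₀ zero_le ?_)))
    exact (norm_unif_lt_one (k := k)).le
  rw [symLMod_eq hm (n := Units.mk0 _ hm0) (div_mem_unitFilL h2.le),
    symM_steinberg (by simp), map_one]

theorem symLMod_of_left {i : ℕ+} {u : (StdField k)ˣ} (hu : u ∈ unitFilL k i) (g : (StdField k)ˣ) :
    symLMod k i u g = 1 := by
  rw [symLMod_eq (m := 1) (by rw [map_one, one_div]; exact inv_mem hu) (approx_spec i g), map_one, MonoidHom.one_apply, map_one]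

theorem symLMod_of_right {i : ℕ+} {u : (StdField k)ˣ} (hu : u ∈ unitFilL k i) (g : (StdField k)ˣ) :
    symLMod k i g u = 1 := by
  rw [symLMod_eq (n := 1) (approx_spec i g) (by rw [map_one, one_div]; exact inv_mem hu), map_one, map_one]

end ValuationL

/-! ### Homomorphisms out of Milnor's K₂ -/

section MilnorLift
variable {F Q : Type*} [Field F] [CommGroup Q]

theorem milnorK2_induction {P : MilnorK2 F → Prop} (x : MilnorK2 F)
    (sym : ∀ a b : Fˣ, P (milnorSymbol a b)) (add : ∀ x y, P x → P y → P (x + y)) : P x := by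
  obtain ⟨t, rfl⟩ := QuotientAddGroup.mk_surjective x
  induction t using TensorProduct.induction_on with
  | zero =>
    have : milnorSymbol (1 : Fˣ) 1 = (QuotientAddGroup.mk 0 : MilnorK2 F) := by
      rw [milnorSymbol, ofMul_one, TensorProduct.zero_tmul]
    rw [← this]
    exact sym 1 1
  | tmul a b => exact sym a.toMul b.toMul
  | add x y hx hy => exact add _ _ hx hy

theorem milnorSymbol_mul_left (a b c : Fˣ) :
    milnorSymbol (a * b) c = milnorSymbol a c + milnorSymbol b c := by
  rw [milnorSymbol, ofMul_mul, TensorProduct.add_tmul]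
  rfl

theorem milnorSymbol_mul_right (a b c : Fˣ) :
    milnorSymbol a (b * c) = milnorSymbol a b + milnorSymbol a c := by
  rw [milnorSymbol, ofMul_mul, TensorProduct.tmul_add]
  rfl

/-- The homomorphism from `Fˣ ⊗ Fˣ` given by a bimultiplicative map. -/
def tensorLift (φ : Fˣ →* Fˣ →* Q) : (Additive Fˣ ⊗[ℤ] Additive Fˣ) →+ Additive Q :=
  TensorProduct.liftAddHom
    (AddMonoidHom.mk' (fun x => MonoidHom.toAdditive (φ x.toMul)) fun x y => by
      ext z
      simp)
    (fun r x y => by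
      change Additive.ofMul (φ (x.toMul ^ r) y.toMul) = Additive.ofMul (φ x.toMul (y.toMul ^ r))
      rw [map_zpow, map_zpow]
      rfl)

theorem tensorLift_tmul (φ : Fˣ →* Fˣ →* Q) (a b : Fˣ) :
    tensorLift φ (Additive.ofMul a ⊗ₜ[ℤ] Additive.ofMul b) = Additive.ofMul (φ a b) := rfl

/-- The homomorphism from `K₂(F)` given by a bimultiplicative map with the Steinberg property. -/
def milnorLift (φ : Fˣ →* Fˣ →* Q) (h : ∀ a b : Fˣ, (a : F) + b = 1 → φ a b = 1) :
    MilnorK2 F →+ Additive Q :=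
  QuotientAddGroup.lift _ (tensorLift φ) (by
    rw [steinbergRelations, AddSubgroup.closure_le]
    rintro _ ⟨a, b, hab, rfl⟩
    rw [SetLike.mem_coe, AddMonoidHom.mem_ker, tensorLift_tmul, h a b hab]
    rfl)

theorem milnorLift_symbol (φ : Fˣ →* Fˣ →* Q) (h : ∀ a b : Fˣ, (a : F) + b = 1 → φ a b = 1)
    (a b : Fˣ) : milnorLift φ h (milnorSymbol a b) = Additive.ofMul (φ a b) := rfl

end MilnorLift

/-! ### Separatedness and completeness of kˣ, and uniqueness of the value on M -/

section Boundary

variable {k : Type*} [NontriviallyNormedField k] [IsUltrametricDist k] [ProperSpace k]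

theorem unitFil_antitone {i j : ℕ+} (h : i ≤ j) : unitFil k j ≤ unitFil k i := by
  intro u hu
  rw [mem_unitFil] at *
  exact hu.trans (pow_le_pow_of_le_one (norm_nonneg _) norm_unif_lt_one.le h)

theorem eq_of_forall_unitsMk_eq {x y : kˣ} (h : ∀ i, unitsMk k i x = unitsMk k i y) : x = y := by
  rw [← div_eq_one]
  ext
  rw [← sub_eq_zero, ← norm_eq_zero, Units.val_one]
  refine le_antisymm (le_of_forall_pos_le_add fun ε hε => ?_) (norm_nonneg _)
  obtain ⟨n, hn⟩ := exists_pow_lt_of_lt_one hε (norm_unif_lt_one (k := k))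
  have h1 := mem_unitFil.1 (unitsMk_eq_iff.1 (h n.succPNat))
  rw [zero_add]
  refine h1.trans (le_trans ?_ hn.le)
  exact pow_le_pow_of_le_one (norm_nonneg _) norm_unif_lt_one.le (by simp)

theorem norm_eq_one_of_mem_unitFil {i : ℕ+} {u : kˣ} (hu : u ∈ unitFil k i) : ‖(u : k)‖ = 1 := by
  have h1 : ‖(u : k) - 1‖ < 1 :=
    (mem_unitFil.1 hu).trans_lt (pow_lt_one₀ (norm_nonneg _) norm_unif_lt_one i.ne_zero)
  have := valuation_eq_one_of_sub_lt (NormedField.valuation (K := k)) (x := u) h1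
  exact congrArg NNReal.toReal this

theorem norm_sub_le_of_div_mem {i : ℕ+} {x y : kˣ} (h : x / y ∈ unitFil k i) :
    ‖(x : k) - y‖ ≤ ‖(unif k : k)‖ ^ (i : ℕ) * ‖(y : k)‖ := by
  have h1 := mem_unitFil.1 h
  rw [Units.val_div_eq_div_val, div_sub_one y.ne_zero, norm_div] at h1
  exact (div_le_iff₀ (norm_pos_iff.2 y.ne_zero)).1 h1

theorem norm_eq_of_div_mem {i : ℕ+} {x y : kˣ} (h : x / y ∈ unitFil k i) :
    ‖(x : k)‖ = ‖(y : k)‖ := by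
  have h1 := norm_eq_one_of_mem_unitFil h
  rw [Units.val_div_eq_div_val, norm_div] at h1
  exact (div_eq_one_iff_eq (norm_ne_zero_iff.2 y.ne_zero)).1 h1

theorem div_mem_of_norm_sub_le {i : ℕ+} {x y : kˣ}
    (h : ‖(x : k) - y‖ ≤ ‖(unif k : k)‖ ^ (i : ℕ) * ‖(y : k)‖) : x / y ∈ unitFil k i := by
  rw [mem_unitFil, Units.val_div_eq_div_val, div_sub_one y.ne_zero, norm_div]
  exact (div_le_iff₀ (norm_pos_iff.2 y.ne_zero)).2 h

/-- `kˣ` is complete for the filtration by the subgroups `U^i`. -/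
theorem exists_forall_unitsMk_eq (z : ℕ+ → kˣ) (hz : ∀ i j, i ≤ j → z j / z i ∈ unitFil k i) :
    ∃ x : kˣ, ∀ i, unitsMk k i x = unitsMk k i (z i) := by
  -- The norm is constant along the sequence, so multiplicative closeness is additive closeness and
  -- the limit is nonzero.
  have hnorm : ∀ j, ‖(z j : k)‖ = ‖(z 1 : k)‖ := fun j => norm_eq_of_div_mem (hz 1 j one_le)
  have hc : CauchySeq fun i => (z i : k) := by
    rw [Metric.cauchySeq_iff']
    intro ε hε
    have hpos : 0 < ‖(z 1 : k)‖ := norm_pos_iff.2 (z 1).ne_zero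
    obtain ⟨N, hN⟩ := exists_pow_lt_of_lt_one (div_pos hε hpos) (norm_unif_lt_one (k := k))
    refine ⟨N.succPNat, fun n hn => ?_⟩
    rw [dist_eq_norm]
    refine (norm_sub_le_of_div_mem (hz _ _ hn)).trans_lt ?_
    rw [hnorm, ← lt_div_iff₀ hpos]
    refine lt_of_le_of_lt ?_ hN
    exact pow_le_pow_of_le_one (norm_nonneg _) norm_unif_lt_one.le (by simp)
  obtain ⟨l, hl⟩ := cauchySeq_tendsto_of_complete hc
  have hln : ‖l‖ = ‖(z 1 : k)‖ :=
    tendsto_nhds_unique hl.norm (by simp only [hnorm]; exact tendsto_const_nhds)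
  have hl0 : l ≠ 0 := by
    rw [← norm_ne_zero_iff, hln]
    exact norm_ne_zero_iff.2 (z 1).ne_zero
  refine ⟨Units.mk0 l hl0, fun i => unitsMk_eq_iff.2 (div_mem_of_norm_sub_le ?_)⟩
  refine le_of_tendsto (hl.sub_const (z i : k)).norm ?_
  filter_upwards [Filter.eventually_ge_atTop i] with j hj using norm_sub_le_of_div_mem (hz i j hj)

theorem WeierstrassData.eq_div (D : WeierstrassData k) {f : (FracField k)ˣ} (hf : D.Represents f) :
    f = tripleToM k (D.const, ⟨D.num, D.num_distinguished⟩, OneUnit.mk D.unit D.unit_const) /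
      tripleToM k (1, ⟨D.den, D.den_distinguished⟩, 1) := by
  ext
  rw [hf]
  exact (mkData_represents D.const ⟨D.num, D.num_distinguished⟩ ⟨D.den, D.den_distinguished⟩
    (OneUnit.mk D.unit D.unit_const) D.relPrime).symm

/-- Every choice of Weierstrass data yields the same value, so `IsInducedBoundary` really prescribes
the homomorphism on symbols from M. -/
theorem IsSymbolM.eq_symM {f g : (FracField k)ˣ} {z : kˣ} (h : IsSymbolM f g z) :
    z = symM k f g := by
  obtain ⟨D, E, hD, hE, hz⟩ := h
  rw [D.eq_div hD, E.eq_div hE, symM_div_div]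
  ext
  apply (algebraMap k (AlgebraicClosure k)).injective
  rw [hz, weierstrassSymbol]
  simp only [Units.val_mul, Units.val_div_eq_div_val, Units.val_zpow_eq_zpow_val, map_mul, map_div₀,
    map_zpow₀, algebraMap_normUnit, Units.val_neg, Units.val_one, map_neg, map_one]
  rfl

end Boundary

/-! ### From compatible symbols modulo U^i to the completed K₂ -/

section SymbolSystem

variable {k : Type*} [NontriviallyNormedField k] [IsUltrametricDist k] [ProperSpace k]
  {F Γ : Type*} [Field F] [LinearOrderedCommGroupWithZero Γ] {v : Valuation F Γ}

/-- A compatible system of symbols on `F` with values in the groups `kˣ / U^i`, which respects the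
filtrations. -/
structure IsSymbolSystem (v : Valuation F Γ) (φ : ∀ i : ℕ+, Fˣ →* Fˣ →* UnitsMod k i) : Prop where
  steinberg : ∀ (i : ℕ+) (a b : Fˣ), (a : F) + b = 1 → φ i a b = 1
  of_left : ∀ i, ∀ u ∈ higherUnits v i, ∀ x, φ i u x = 1
  of_right : ∀ i, ∀ u ∈ higherUnits v i, ∀ x, φ i x u = 1
  compatible : ∀ i j, i ≤ j → ∀ a b, ∃ z : kˣ, φ j a b = unitsMk k j z ∧ φ i a b = unitsMk k i z

variable {φ : ∀ i : ℕ+, Fˣ →* Fˣ →* UnitsMod k i} (hφ : IsSymbolSystem v φ)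

/-- The map `K₂(F) / U^i K₂(F) → kˣ / U^i` induced by the symbol. -/
def IsSymbolSystem.boundaryMod (i : ℕ+) :
    MilnorK2 F ⧸ filtrationK2 v i →+ Additive (UnitsMod k i) :=
  QuotientAddGroup.lift _ (milnorLift (φ i) (hφ.steinberg i)) (by
    rw [filtrationK2, AddSubgroup.closure_le]
    rintro _ ⟨u, hu, x, rfl | rfl⟩
    · rw [SetLike.mem_coe, AddMonoidHom.mem_ker, milnorLift_symbol, hφ.of_left i u hu]
      rfl
    · rw [SetLike.mem_coe, AddMonoidHom.mem_ker, milnorLift_symbol, hφ.of_right i u hu]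
      rfl)

theorem IsSymbolSystem.boundaryMod_symbol (i : ℕ+) (f g : Fˣ) :
    hφ.boundaryMod i (QuotientAddGroup.mk (milnorSymbol f g)) = Additive.ofMul (φ i f g) :=
  rfl

/-- Compatibility is phrased by a common lift z to kˣ, which is multiplicative and so passes from
symbols to sums. -/
theorem IsSymbolSystem.boundaryMod_transition {i j : ℕ+} (h : i ≤ j)
    (x : MilnorK2 F ⧸ filtrationK2 v j) :
    ∃ z : kˣ, hφ.boundaryMod j x = Additive.ofMul (unitsMk k j z) ∧
      hφ.boundaryMod i (transitionK2 v h x) = Additive.ofMul (unitsMk k i z) := by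
  obtain ⟨y, rfl⟩ := QuotientAddGroup.mk_surjective x
  change ∃ z : kˣ, _ ∧ hφ.boundaryMod i (QuotientAddGroup.mk y) = _
  induction y using milnorK2_induction with
  | sym a b =>
    obtain ⟨z, h1, h2⟩ := hφ.compatible i j h a b
    exact ⟨z, congrArg Additive.ofMul h1, congrArg Additive.ofMul h2⟩
  | add x y hx hy =>
    obtain ⟨z, h1, h2⟩ := hx
    obtain ⟨w, h3, h4⟩ := hy
    refine ⟨z * w, ?_, ?_⟩
    · rw [QuotientAddGroup.mk_add, map_add, h1, h3, map_mul]
      rfl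
    · rw [QuotientAddGroup.mk_add, map_add, h2, h4, map_mul]
      rfl

include hφ in
-- Lifts of the values at the different levels form a sequence compatible modulo the U^i, which
-- converges because kˣ is complete.
theorem IsSymbolSystem.exists_boundary_value (x : CompletedK2 v) :
    ∃ z : kˣ, ∀ i, Additive.ofMul (unitsMk k i z) = hφ.boundaryMod i (x.1 i) := by
  choose z hz using fun i => unitsMk_surjective (k := k) i (hφ.boundaryMod i (x.1 i)).toMul
  obtain ⟨y, hy⟩ := exists_forall_unitsMk_eq z (fun i j hij => by
    obtain ⟨w, h1, h2⟩ := hφ.boundaryMod_transition hij (x.1 j)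
    rw [x.2 i j hij] at h2
    have h3 : unitsMk k j (z j) = unitsMk k j w := (hz j).trans (congrArg Additive.toMul h1)
    have h4 : unitsMk k i (z i) = unitsMk k i w := (hz i).trans (congrArg Additive.toMul h2)
    have h5 := mul_mem (unitFil_antitone hij (unitsMk_eq_iff.1 h3))
      (inv_mem (unitsMk_eq_iff.1 h4))
    rwa [inv_div, div_mul_div_cancel] at h5)
  exact ⟨y, fun i => by rw [hy, hz]; rfl⟩

/-- The boundary homomorphism, as the limit of the homomorphisms `boundaryMod`. -/
def IsSymbolSystem.boundaryHom : CompletedK2 v →+ Additive kˣ :=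
  AddMonoidHom.mk' (fun x => Additive.ofMul (hφ.exists_boundary_value x).choose) fun x y => by
    apply Additive.toMul.injective
    refine eq_of_forall_unitsMk_eq fun i => Additive.ofMul.injective ?_
    have h1 := (hφ.exists_boundary_value (x + y)).choose_spec i
    have h2 := (hφ.exists_boundary_value x).choose_spec i
    have h3 := (hφ.exists_boundary_value y).choose_spec i
    have h4 : (x + y).1 i = x.1 i + y.1 i := rfl
    rw [h4, map_add, ← h2, ← h3] at h1
    rw [toMul_ofMul, h1, toMul_add, map_mul]
    rfl

theorem IsSymbolSystem.unitsMk_boundaryHom (x : CompletedK2 v) (i : ℕ+) :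
    Additive.ofMul (unitsMk k i (hφ.boundaryHom x).toMul) = hφ.boundaryMod i (x.1 i) :=
  (hφ.exists_boundary_value x).choose_spec i

/-- A homomorphism which respects the filtrations and extends a symbol defined on a dense subgroup
is determined by that symbol. -/
theorem IsSymbolSystem.unitsMk_apply {G : Type*} [CommGroup G] {j : G →* Fˣ} {s : G →* G →* kˣ}
    (hs : ∀ i m n, φ i (j m) (j n) = unitsMk k i (s m n))
    (hj : ∀ i a, ∃ m, ∃ u ∈ higherUnits v i, a = j m * u)
    {d : CompletedK2 v →+ Additive kˣ}
    (hd : ∀ m n, (d (toCompletedK2 v (milnorSymbol (j m) (j n)))).toMul = s m n)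
    (hfil : ∀ (i : ℕ+) (x : CompletedK2 v), x.1 i = 0 → (d x).toMul ∈ unitFil k i)
    (i : ℕ+) (x : CompletedK2 v) :
    Additive.ofMul (unitsMk k i (d x).toMul) = hφ.boundaryMod i (x.1 i) := by
  have key : ∀ y : MilnorK2 F, Additive.ofMul (unitsMk k i (d (toCompletedK2 v y)).toMul) =
      hφ.boundaryMod i (QuotientAddGroup.mk y) := by
    intro y
    induction y using milnorK2_induction with
    | sym a b =>
      have hfil' : ∀ t : MilnorK2 F, t ∈ filtrationK2 v i →
          unitsMk k i (d (toCompletedK2 v t)).toMul = 1 := by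
        intro t ht
        rw [unitsMk_eq_one_iff]
        exact hfil i _ ((QuotientAddGroup.eq_zero_iff t).2 ht)
      -- Splitting off higher units changes the symbol by elements of U^i K₂, invisible to both
      -- sides modulo U^i.
      obtain ⟨m, u, hu, rfl⟩ := hj i a
      obtain ⟨n, w, hw, rfl⟩ := hj i b
      rw [milnorSymbol_mul_left, milnorSymbol_mul_right (j m)]
      have h1 : milnorSymbol (j m) w ∈ filtrationK2 v i :=
        AddSubgroup.subset_closure ⟨w, hw, _, Or.inr rfl⟩
      have h2 : milnorSymbol u (j n * w) ∈ filtrationK2 v i :=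
        AddSubgroup.subset_closure ⟨u, hu, _, Or.inl rfl⟩
      have e1 := (QuotientAddGroup.eq_zero_iff _).2 h1
      have e2 := (QuotientAddGroup.eq_zero_iff _).2 h2
      rw [QuotientAddGroup.mk_add, QuotientAddGroup.mk_add, e1, e2, add_zero, add_zero,
        hφ.boundaryMod_symbol, hs]
      refine congrArg Additive.ofMul ?_
      rw [map_add (toCompletedK2 v), map_add (toCompletedK2 v), map_add d, map_add d, toMul_add,
        toMul_add, map_mul (unitsMk k i), map_mul (unitsMk k i), hfil' _ h1, hfil' _ h2, mul_one,
        mul_one, hd]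
    | add x y hx hy =>
      rw [map_add, map_add, toMul_add, map_mul, ofMul_mul, hx, hy, QuotientAddGroup.mk_add, map_add]
  -- At level i any x agrees with the image of some element of K₂(F), and the difference is
  -- controlled by the filtration hypothesis.
  obtain ⟨y, hy⟩ := QuotientAddGroup.mk_surjective (x.1 i)
  rw [← hy, ← key y]
  congr 1
  rw [unitsMk_eq_iff, ← toMul_sub, ← map_sub]
  refine hfil i _ ?_
  change x.1 i - QuotientAddGroup.mk y = 0
  rw [hy, sub_self]

end SymbolSystem

/-! ### Existence and uniqueness of the boundary homomorphism -/

section BoundaryL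

variable {k : Type*} [NontriviallyNormedField k] [IsUltrametricDist k] [ProperSpace k]

theorem unitFilL_antitone {i j : ℕ+} (h : i ≤ j) : unitFilL k j ≤ unitFilL k i := by
  intro u hu
  rw [mem_unitFilL] at *
  have h1 : ‖(unif k : k)‖₊ ≤ 1 := (norm_unif_lt_one (k := k)).le
  exact hu.trans (pow_le_pow_of_le_one zero_le h1 h)

theorem isSymbolSystem_symLMod : IsSymbolSystem (valL k) (symLMod k) where
  steinberg i _ _ h := symLMod_steinberg i h
  of_left _ _ hu _ := symLMod_of_left (mem_higherUnits_valL_iff.1 hu) _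
  of_right _ _ hu _ := symLMod_of_right (mem_higherUnits_valL_iff.1 hu) _
  compatible _ j hij a b := ⟨symM k (approx j a) (approx j b),
    symLMod_eq (approx_spec j a) (approx_spec j b),
    symLMod_eq (unitFilL_antitone hij (approx_spec j a)) (unitFilL_antitone hij (approx_spec j b))⟩

theorem isInducedBoundary_boundaryHom :
    IsInducedBoundary (isSymbolSystem_symLMod (k := k)).boundaryHom where
  extends_symbolM f g := by
    have : ((isSymbolSystem_symLMod (k := k)).boundaryHom
        (completedSymbol (Units.map (mToL k) f) (Units.map (mToL k) g))).toMul = symM k f g :=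
      eq_of_forall_unitsMk_eq fun i => Additive.ofMul.injective <|
        ((isSymbolSystem_symLMod (k := k)).unitsMk_boundaryHom _ i).trans
          (congrArg Additive.ofMul (symLMod_unitsMToL i f g))
    rw [this]
    exact isSymbolM_symM f g
  filtered i x hx := by
    rw [mem_higherUnits_iff, ← unitsMk_eq_one_iff]
    apply Additive.ofMul.injective
    rw [(isSymbolSystem_symLMod (k := k)).unitsMk_boundaryHom, hx, map_zero]
    rfl

theorem exists_eq_unitsMToL_mul (i : ℕ+) (a : (StdField k)ˣ) :
    ∃ m : (FracField k)ˣ, ∃ u ∈ higherUnits (valL k) i, a = unitsMToL k m * u :=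
  ⟨approx i a, (unitsMToL k (approx i a) / a)⁻¹,
    mem_higherUnits_valL_iff.2 (inv_mem (approx_spec i a)), by
      rw [inv_div]
      exact (mul_div_cancel (unitsMToL k (approx i a)) a).symm⟩

theorem IsInducedBoundary.unitsMk_apply {d : CompletedK2 (valL k) →+ Additive kˣ}
    (hd : IsInducedBoundary d) (i : ℕ+) (x : CompletedK2 (valL k)) :
    Additive.ofMul (unitsMk k i (d x).toMul) = (isSymbolSystem_symLMod (k := k)).boundaryMod i (x.1 i) :=
  (isSymbolSystem_symLMod (k := k)).unitsMk_apply symLMod_unitsMToL exists_eq_unitsMToL_mul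
    (fun m n => (hd.extends_symbolM m n).eq_symM)
    (fun i x hx => mem_higherUnits_iff.1 (hd.filtered i x hx)) i x

/-- The induced boundary homomorphism exists and is unique. -/
theorem existsUnique_isInducedBoundary :
    ∃! d : CompletedK2 (valL k) →+ Additive kˣ, IsInducedBoundary d := by
  refine ⟨(isSymbolSystem_symLMod (k := k)).boundaryHom, isInducedBoundary_boundaryHom, fun d hd => ?_⟩
  refine AddMonoidHom.ext fun x => Additive.toMul.injective ?_
  exact eq_of_forall_unitsMk_eq fun i => Additive.ofMul.injective <|
    (hd.unitsMk_apply i x).trans (isInducedBoundary_boundaryHom.unitsMk_apply i x).symm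

/-- Existence makes the epsilon choice in `boundaryL` a genuine induced boundary, so the symbol on L
is computed modulo U^i from approximations in M. -/
theorem unitsMk_symbolL (i : ℕ+) (f g : (StdField k)ˣ) :
    unitsMk k i (symbolL f g) = symLMod k i f g := by
  have h : IsInducedBoundary (boundaryL k) :=
    Classical.epsilon_spec ⟨_, isInducedBoundary_boundaryHom⟩
  exact Additive.ofMul.injective (h.unitsMk_apply i (completedSymbol f g))

end BoundaryL

/-! ### Products over the roots of X^i - c -/

section RootsOfUnity
open Polynomial

variable {C : Type*} [Field C]

theorem prod_range_mul_of_periodic {M : Type*} [CommMonoid M] (f : ℕ → M) (n d : ℕ)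
    (h : ∀ s, f (n + s) = f s) :
    ∏ s ∈ Finset.range (n * d), f s = (∏ s ∈ Finset.range n, f s) ^ d := by
  have h' : ∀ d s, f (n * d + s) = f s := by
    intro d
    induction d with
    | zero => simp
    | succ d ih => intro s; rw [Nat.mul_succ, add_assoc, ih, h]
  induction d with
  | zero => simp
  | succ d ih =>
    rw [Nat.mul_succ, Finset.prod_range_add, ih, pow_succ]
    congr 1
    exact Finset.prod_congr rfl fun s _ => h' d s

/-- Since ζ^j is primitive of order n = i/(i,j), each of its powers occurs (i,j) times, and one
period is the value at 1 of X^n - y^n. -/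
theorem prod_one_sub_rootsOfUnity_pow_mul {i j : ℕ} (hi : 0 < i) (hj : j ≠ 0) {ζ : C} (hζ : IsPrimitiveRoot ζ i)
    (y : C) :
    ∏ s ∈ Finset.range i, (1 - (ζ ^ s) ^ j * y) = (1 - y ^ (i / i.gcd j)) ^ i.gcd j := by
  have hd : 0 < i.gcd j := Nat.gcd_pos_of_pos_left j hi
  have hη : IsPrimitiveRoot (ζ ^ j) (i / i.gcd j) := by
    rw [hζ.eq_orderOf, ← orderOf_pow' _ hj]
    exact IsPrimitiveRoot.orderOf _
  have hn : 0 < i / i.gcd j := Nat.div_pos (Nat.le_of_dvd hi (Nat.gcd_dvd_left i j)) hd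
  have h1 := congrArg (eval 1) (X_pow_sub_C_eq_prod hη hn (α := y) rfl)
  rw [eval_prod] at h1
  simp only [eval_sub, eval_pow, eval_X, eval_C, one_pow] at h1
  rw [h1, ← prod_range_mul_of_periodic _ _ (i.gcd j), Nat.div_mul_cancel (Nat.gcd_dvd_left i j)]
  · exact Finset.prod_congr rfl fun s _ => by rw [← pow_mul, ← pow_mul, mul_comm s]
  · intro s
    rw [pow_add, hη.pow_eq_one, one_mul]

/-- The roots are ζ^s α with α^i = c and ζ a primitive i-th root of unity, which exists for every i
in characteristic zero. -/
theorem prod_roots_X_pow_sub_C [IsAlgClosed C] [CharZero C] {i j : ℕ} (hi : 0 < i) (hj : j ≠ 0) (c g : C) :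
    ((X ^ i - Polynomial.C c).roots.map fun α => 1 - g * α ^ j).prod =
      (1 - c ^ (j / i.gcd j) * g ^ (i / i.gcd j)) ^ i.gcd j := by
  have : NeZero (i : C) := ⟨Nat.cast_ne_zero.2 hi.ne'⟩
  have : NeZero i := ⟨hi.ne'⟩
  obtain ⟨ζ, hζ⟩ := HasEnoughRootsOfUnity.exists_primitiveRoot C i
  obtain ⟨α, hα⟩ := IsAlgClosed.exists_pow_nat_eq c hi
  have h0 : X ^ i - Polynomial.C c =
      (((Multiset.range i).map fun s => ζ ^ s * α).map fun r => X - Polynomial.C r).prod := by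
    rw [X_pow_sub_C_eq_prod hζ hi hα, Multiset.map_map]
    rfl
  rw [h0, roots_multiset_prod_X_sub_C, Multiset.map_map]
  change ∏ s ∈ Finset.range i, (1 - g * (ζ ^ s * α) ^ j) = _
  have h1 : c ^ (j / i.gcd j) = (α ^ j) ^ (i / i.gcd j) := by
    rw [← hα, ← pow_mul, ← pow_mul]
    congr 1
    rw [← Nat.mul_div_assoc _ (Nat.gcd_dvd_right i j), ← Nat.mul_div_assoc _ (Nat.gcd_dvd_left i j),
      mul_comm]
  rw [h1, ← mul_pow, ← prod_one_sub_rootsOfUnity_pow_mul hi hj hζ]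
  exact Finset.prod_congr rfl fun s _ => by rw [mul_pow]; ring

end RootsOfUnity

/-! ### The factors of the product formula as root products -/

section Factors
open Polynomial

variable {k : Type*} [NontriviallyNormedField k] [IsUltrametricDist k] [ProperSpace k]

variable (k) in
/-- The distinguished polynomial `T`. -/
def distX : DistPoly k :=
  ⟨X, ⟨⟨fun {n} h => by
    rw [natDegree_X] at h
    rw [Nat.lt_one_iff.1 h, coeff_X_zero]
    exact zero_mem _⟩, monic_X⟩⟩

/-- The distinguished polynomial `T^i - c`. -/
def distXPowSub (i : ℕ+) (c : IntegerRing k)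
    (hc : c ∈ IsLocalRing.maximalIdeal (IntegerRing k)) : DistPoly k :=
  ⟨X ^ (i : ℕ) - C c, ⟨⟨fun {n} h => by
    rw [natDegree_X_pow_sub_C] at h
    rw [coeff_sub, coeff_X_pow, if_neg h.ne, coeff_C, zero_sub]
    split_ifs
    · exact neg_mem hc
    · simp⟩, monic_X_pow_sub_C c i.ne_zero⟩⟩

/-- The factor `(1 - c^{j/(i,j)} g^{i/(i,j)})^{(i,j)}`. -/
def factor (c g : IntegerRing k) (i j : ℕ+) : IntegerRing k :=
  (1 - c ^ ((j : ℕ) / Nat.gcd i j) * g ^ ((i : ℕ) / Nat.gcd i j)) ^ Nat.gcd i j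

theorem normRoot_one_sub [CharZero k] (i j : ℕ+) {c : IntegerRing k}
    (hc : c ∈ IsLocalRing.maximalIdeal (IntegerRing k)) (g : IntegerRing k) :
    normRoot (X ^ (i : ℕ) - C c) (1 - PowerSeries.C g * PowerSeries.X ^ (j : ℕ)) =
      factor c g i j := by
  have hd : IsDist (X ^ (i : ℕ) - C c) := (distXPowSub i c hc).2
  have : CharZero (AlgebraicClosure k) :=
    charZero_of_injective_algebraMap (algebraMap k (AlgebraicClosure k)).injective
  apply intToClosure_injective
  rw [intToClosure_normRoot hd, factor, map_pow, map_sub, map_mul, map_pow, map_pow, map_one,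
    ← prod_roots_X_pow_sub_C i.pos j.ne_zero, prodOverRoots]
  have h1 : rootsInClosure (X ^ (i : ℕ) - C c) = (X ^ (i : ℕ) - C (intToClosure k c)).roots := by
    rw [rootsInClosure_def, Polynomial.map_sub, Polynomial.map_pow, map_X, map_C]
  rw [← h1]
  congr 1
  refine Multiset.map_congr rfl fun α hα => ?_
  have hα' := (mem_rootsInClosure hd.monic.ne_zero).1 hα
  rw [evalInClosure_eq hd hα', map_sub, map_mul, map_pow, map_one, evalHom_C, evalHom_X]

theorem unif_dvd_of_mem {c : IntegerRing k}
    (hc : c ∈ IsLocalRing.maximalIdeal (IntegerRing k)) : unif k ∣ c := by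
  rwa [maximalIdeal_eq_span, Ideal.mem_span_singleton] at hc

/-- Modulo T^i - c one has T^{ie} ≡ c^e, which is divisible by π^e; so T-adic closeness becomes
π-adic closeness of the values. -/
theorem unif_pow_dvd_normRoot_sub (i : ℕ+) {c : IntegerRing k}
    (hc : c ∈ IsLocalRing.maximalIdeal (IntegerRing k)) (e : ℕ) {u v : PowerRing k}
    (h : PowerSeries.X ^ ((i : ℕ) * e) ∣ u - v) :
    unif k ^ e ∣ normRoot (X ^ (i : ℕ) - C c) u - normRoot (X ^ (i : ℕ) - C c) v := by
  have hd : IsDist (X ^ (i : ℕ) - C c) := (distXPowSub i c hc).2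
  obtain ⟨w, hw⟩ := h
  have h1 : (X ^ (i : ℕ) - C c) ∣ (X ^ (i : ℕ)) ^ e - C c ^ e := sub_dvd_pow_sub_pow _ _ e
  obtain ⟨t, ht⟩ := h1
  have ht' := congrArg (fun p : (IntegerRing k)[X] => (p : PowerRing k)) ht
  simp only [coe_sub, coe_pow, coe_X, coe_C, coe_mul] at ht'
  have h2 : u = ((X ^ (i : ℕ) - C c : (IntegerRing k)[X]) : PowerRing k) * (t * w) +
      (v + PowerSeries.C (c ^ e) * w) := by
    simp only [coe_sub, coe_pow, coe_X, coe_C, map_pow]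
    linear_combination hw + w * ht' + w * pow_mul (PowerSeries.X : PowerRing k) i e
  rw [normRoot_eq_of_dvd_sub hd (v := v + PowerSeries.C (c ^ e) * w)
    ⟨t * w, by rw [h2]; ring⟩]
  exact (pow_dvd_pow_of_dvd (unif_dvd_of_mem hc) e).trans
    (normRoot_congr hd hd rfl (r := 0) (by simp) rfl)

end Factors

/-! ### Infinite products modulo U^e -/

section Products
open Polynomial

variable {k : Type*} [NontriviallyNormedField k] [IsUltrametricDist k] [ProperSpace k]

theorem X_pow_dvd_prod_sub_prod (p : ℕ+ → IntegerRing k) {n : ℕ} {S T : Finset ℕ+} (hST : S ⊆ T)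
    (hS : ∀ j : ℕ+, (j : ℕ) < n → j ∈ S) :
    PowerSeries.X ^ n ∣
      ∏ j ∈ T, (1 - PowerSeries.C (p j) * PowerSeries.X ^ (j : ℕ) : PowerRing k) -
      ∏ j ∈ S, (1 - PowerSeries.C (p j) * PowerSeries.X ^ (j : ℕ) : PowerRing k) := by
  rw [← Ideal.mem_span_singleton, ← Ideal.Quotient.eq, map_prod, map_prod]
  symm
  refine Finset.prod_subset hST fun j _ hj => ?_
  rw [← map_one (Ideal.Quotient.mk _), Ideal.Quotient.eq, Ideal.mem_span_singleton]
  have h : n ≤ j := not_lt.1 fun h => hj (hS j h)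
  refine (pow_dvd_pow PowerSeries.X h).trans ⟨-PowerSeries.C (p j), by ring⟩

open scoped PowerSeries.WithPiTopology in
-- Each coefficient below degree n is constant along the finite products containing S, so it equals
-- the limiting coefficient.
theorem X_pow_dvd_sub_prod {p : ℕ+ → IntegerRing k} {P : PowerRing k}
    (hP : HasProd (fun i : ℕ+ => (1 - PowerSeries.C (p i) * PowerSeries.X ^ (i : ℕ) : PowerRing k)) P)
    {n : ℕ} {S : Finset ℕ+} (hS : ∀ j : ℕ+, (j : ℕ) < n → j ∈ S) :
    PowerSeries.X ^ n ∣
      P - ∏ j ∈ S, (1 - PowerSeries.C (p j) * PowerSeries.X ^ (j : ℕ) : PowerRing k) := by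
  rw [PowerSeries.X_pow_dvd_iff]
  intro m hm
  rw [map_sub, sub_eq_zero]
  rw [HasProd, SummationFilter.unconditional_filter] at hP
  have h1 := ((PowerSeries.WithPiTopology.continuous_coeff (IntegerRing k) m).tendsto P).comp hP
  refine tendsto_nhds_unique h1 (tendsto_const_nhds.congr' ?_)
  filter_upwards [Filter.eventually_ge_atTop S] with T hT
  have h2 := PowerSeries.X_pow_dvd_iff.1 (X_pow_dvd_prod_sub_prod p hT hS) m hm
  rw [map_sub, sub_eq_zero] at h2
  exact h2.symm

open scoped PowerSeries.WithPiTopology in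
theorem constantCoeff_of_hasProd {p : ℕ+ → IntegerRing k} {P : PowerRing k}
    (hP : HasProd (fun i : ℕ+ => (1 - PowerSeries.C (p i) * PowerSeries.X ^ (i : ℕ) : PowerRing k)) P) :
    PowerSeries.constantCoeff P = 1 := by
  have h := PowerSeries.X_pow_dvd_iff.1 (X_pow_dvd_sub_prod hP (n := 1) (S := ∅)
    fun j hj => absurd (Nat.lt_one_iff.1 hj) j.ne_zero) 0 one_pos
  rw [Finset.prod_empty, map_sub, sub_eq_zero] at h
  simpa using h

theorem div_gcd_pos (i j : ℕ+) : 0 < (j : ℕ) / Nat.gcd i j :=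
  Nat.div_pos (Nat.le_of_dvd j.pos (Nat.gcd_dvd_right _ _)) (Nat.gcd_pos_of_pos_right _ j.pos)

theorem dvd_factor_sub_one (c g : IntegerRing k) (i j : ℕ+) :
    c ^ ((j : ℕ) / Nat.gcd i j) ∣ factor c g i j - 1 := by
  have h := sub_dvd_pow_sub_pow
    (1 - c ^ ((j : ℕ) / Nat.gcd i j) * g ^ ((i : ℕ) / Nat.gcd i j)) 1 (Nat.gcd i j)
  rw [one_pow] at h
  refine Dvd.dvd.trans ⟨-g ^ ((i : ℕ) / Nat.gcd i j), by ring⟩ h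

theorem factor_ne_zero {c : IntegerRing k} (hc : c ∈ IsLocalRing.maximalIdeal (IntegerRing k))
    (g : IntegerRing k) (i j : ℕ+) : factor c g i j ≠ 0 := by
  intro h
  have h1 := dvd_factor_sub_one c g i j
  rw [h, zero_sub] at h1
  have h2 : c ∣ 1 := ((dvd_pow_self c (div_gcd_pos i j).ne').trans h1).trans ⟨-1, by ring⟩
  exact (IsLocalRing.mem_maximalIdeal c).1 hc (isUnit_of_dvd_one h2)

/-- The factor `(1 - c^{j/(i,j)} g^{i/(i,j)})^{(i,j)}` as an element of `kˣ`. -/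
def factorUnit {c : IntegerRing k} (hc : c ∈ IsLocalRing.maximalIdeal (IntegerRing k))
    (g : IntegerRing k) (i j : ℕ+) : kˣ := intUnit (factor c g i j) (factor_ne_zero hc g i j)

theorem coe_factorUnit {c : IntegerRing k} (hc : c ∈ IsLocalRing.maximalIdeal (IntegerRing k))
    (g : IntegerRing k) (i j : ℕ+) : (factorUnit hc g i j : k) =
      (1 - (c : k) ^ ((j : ℕ) / Nat.gcd i j) * (g : k) ^ ((i : ℕ) / Nat.gcd i j)) ^ Nat.gcd i j := by
  rw [factorUnit, coe_intUnit, factor]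
  push_cast
  rfl

theorem unitsMk_intUnit_eq_one {x : IntegerRing k} (hx : x ≠ 0) {e : ℕ+}
    (h : unif k ^ (e : ℕ) ∣ x - 1) : unitsMk k e (intUnit x hx) = 1 := by
  rw [unitsMk_eq_one_iff, mem_unitFil, coe_intUnit]
  rw [unif_pow_dvd_iff] at h
  exact_mod_cast h

theorem unitsMk_factorUnit_of_dvd {c : IntegerRing k}
    (hc : c ∈ IsLocalRing.maximalIdeal (IntegerRing k)) (g : IntegerRing k) (i j : ℕ+) {e : ℕ+}
    (h : unif k ^ (e : ℕ) ∣ c) : unitsMk k e (factorUnit hc g i j) = 1 :=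
  unitsMk_intUnit_eq_one _
    ((h.trans (dvd_pow_self c (div_gcd_pos i j).ne')).trans (dvd_factor_sub_one c g i j))

theorem unitsMk_factorUnit_of_le {c : IntegerRing k}
    (hc : c ∈ IsLocalRing.maximalIdeal (IntegerRing k)) (g : IntegerRing k) {i j e : ℕ+}
    (h : (i : ℕ) * e ≤ j) : unitsMk k e (factorUnit hc g i j) = 1 := by
  -- As (i,j) ≤ i, the exponent of c is at least j/i ≥ e.
  have h1 : (e : ℕ) ≤ (j : ℕ) / Nat.gcd i j := by
    rw [Nat.le_div_iff_mul_le (Nat.gcd_pos_of_pos_right _ j.pos), mul_comm]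
    exact (Nat.mul_le_mul_right _ (Nat.gcd_le_left _ i.pos)).trans h
  exact unitsMk_intUnit_eq_one _
    (((pow_dvd_pow _ h1).trans (pow_dvd_pow_of_dvd (unif_dvd_of_mem hc) _)).trans
      (dvd_factor_sub_one c g i j))

open scoped PowerSeries.WithPiTopology in
theorem unitsMk_normUnit_distXPowSub [CharZero k] (i : ℕ+) {c : IntegerRing k}
    (hc : c ∈ IsLocalRing.maximalIdeal (IntegerRing k)) {g : ℕ+ → IntegerRing k}
    {P : PowerRing k}
    (hP : HasProd (fun i : ℕ+ => (1 - PowerSeries.C (g i) * PowerSeries.X ^ (i : ℕ) : PowerRing k)) P)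
    (e : ℕ+) {J : Finset ℕ+} (hJ : ∀ j : ℕ+, (j : ℕ) < i * e → j ∈ J) :
    unitsMk k e (normUnit k (distXPowSub i c hc)
      (OneUnit.mk P (constantCoeff_of_hasProd hP) : (PowerRing k)ˣ)) =
      ∏ j ∈ J, unitsMk k e (factorUnit hc (g j) i j) := by
  rw [← map_prod, unitsMk_eq_iff]
  have h1 := unif_pow_dvd_normRoot_sub i hc e (X_pow_dvd_sub_prod hP hJ)
  have h2 : normRoot (X ^ (i : ℕ) - C c)
      (∏ j ∈ J, (1 - PowerSeries.C (g j) * PowerSeries.X ^ (j : ℕ) : PowerRing k)) =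
      ∏ j ∈ J, factor c (g j) i j := by
    refine (map_prod (normRootHom (distXPowSub i c hc)) _ _).trans ?_
    exact Finset.prod_congr rfl fun j _ => normRoot_one_sub i j hc (g j)
  rw [h2, unif_pow_dvd_iff] at h1
  have h3 : ((∏ j ∈ J, factorUnit hc (g j) i j : kˣ) : k) =
      ((∏ j ∈ J, factor c (g j) i j : IntegerRing k) : k) := by
    rw [Units.coe_prod]
    push_cast
    rfl
  have h4 : ‖((∏ j ∈ J, factorUnit hc (g j) i j : kˣ) : k)‖ = 1 := by
    rw [Units.coe_prod, norm_prod]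
    refine Finset.prod_eq_one fun j _ => norm_eq_one_of_mem_unitFil (i := 1) ?_
    rw [← unitsMk_eq_one_iff]
    refine unitsMk_factorUnit_of_dvd hc _ _ _ ?_
    rw [PNat.one_coe, pow_one]
    exact unif_dvd_of_mem hc
  refine div_mem_of_norm_sub_le ?_
  rw [h4, mul_one, h3]
  exact_mod_cast h1

open scoped PowerSeries.WithPiTopology in
/-- The product of the factors with the parameters `c_i` and `g_j` converges to
`∏_i N(T^i - c_i, P)`, modulo `U^e`. -/
theorem prod_unitsMk_factorUnit [CharZero k] {c : ℕ+ → IntegerRing k}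
    (hc : ∀ i, c i ∈ IsLocalRing.maximalIdeal (IntegerRing k)) {g : ℕ+ → IntegerRing k}
    {P : PowerRing k}
    (hP : HasProd (fun i : ℕ+ => (1 - PowerSeries.C (g i) * PowerSeries.X ^ (i : ℕ) : PowerRing k)) P)
    (e : ℕ+) {S : Finset ℕ+} (hS : ∀ i ∉ S, unif k ^ (e : ℕ) ∣ c i) :
    ∃ J : Finset ℕ+, ∀ s : Finset (ℕ+ × ℕ+), S ×ˢ J ⊆ s →
      ∏ ij ∈ s, unitsMk k e (factorUnit (hc ij.1) (g ij.2) ij.1 ij.2) =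
      ∏ i ∈ S, unitsMk k e (normUnit k (distXPowSub i (c i) (hc i))
        (OneUnit.mk P (constantCoeff_of_hasProd hP) : (PowerRing k)ˣ)) := by
  -- One range of j serves all i in S: beyond i e the factors lie in U^e.
  have hJ : ∀ i ∈ S, ∀ j : ℕ+, (j : ℕ) < i * e → j ∈ Finset.Iic (S.sup id * e) := by
    intro i hi j hj
    rw [Finset.mem_Iic, ← PNat.coe_le_coe, PNat.mul_coe]
    exact hj.le.trans (Nat.mul_le_mul_right _ (PNat.coe_le_coe _ _ |>.2 (Finset.le_sup (f := id) hi)))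
  refine ⟨Finset.Iic (S.sup id * e), fun s hs => ?_⟩
  rw [← Finset.prod_subset hs, Finset.prod_product]
  · exact Finset.prod_congr rfl fun i hi =>
      (unitsMk_normUnit_distXPowSub i (hc i) hP e (hJ i hi)).symm
  · rintro ⟨i, j⟩ _ hij
    by_cases hi : i ∈ S
    · refine unitsMk_factorUnit_of_le _ _ (not_lt.1 fun h => hij ?_)
      exact Finset.mem_product.2 ⟨hi, hJ i hi j h⟩
    · exact unitsMk_factorUnit_of_dvd _ _ _ _ (hS i hi)

/-- The relative error of a partial product is at most ‖π‖^e once it contains s₀; quantifying over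
all larger finite sets gives unconditional convergence. -/
theorem hasProd_of_unitsMk {ι : Type*} {u : ι → kˣ} {z : kˣ}
    (h : ∀ e : ℕ+, ∃ s₀ : Finset ι, ∀ s, s₀ ⊆ s → ∏ x ∈ s, unitsMk k e (u x) = unitsMk k e z) :
    HasProd (fun x => (u x : k)) z := by
  classical
  rw [HasProd, SummationFilter.unconditional_filter, Metric.tendsto_atTop]
  intro ε hε
  have hpos : 0 < ‖(z : k)‖ := norm_pos_iff.2 z.ne_zero
  obtain ⟨N, hN⟩ := exists_pow_lt_of_lt_one (div_pos hε hpos) (norm_unif_lt_one (k := k))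
  obtain ⟨s₀, hs₀⟩ := h N.succPNat
  refine ⟨s₀, fun s hs => ?_⟩
  have h1 := hs₀ s hs
  rw [← map_prod, unitsMk_eq_iff] at h1
  have h2 := norm_sub_le_of_div_mem h1
  rw [Units.coe_prod] at h2
  rw [dist_eq_norm]
  refine h2.trans_lt ?_
  rw [← lt_div_iff₀ hpos]
  refine lt_of_le_of_lt ?_ hN
  exact pow_le_pow_of_le_one (norm_nonneg _) norm_unif_lt_one.le (by simp)

end Products

/-! ### Approximating f by elements of M with finitely many negative Witt factors -/

section Approximation
open Polynomial

variable {k : Type*} [NontriviallyNormedField k] [IsUltrametricDist k] [ProperSpace k]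

/-- The only root of T is 0, where u takes the value 1. Hence powers of T affect the symbol only
through the winding number. -/
theorem normUnit_distX (u : OneUnit k) : normUnit k (distX k) (u : (PowerRing k)ˣ) = 1 := by
  ext
  rw [coe_normUnit]
  have h : normRoot (X : (IntegerRing k)[X]) ((u : (PowerRing k)ˣ) : PowerRing k) =
      normRoot X (1 : PowerRing k) := by
    refine normRoot_eq_of_dvd_sub (distX k).2 ?_
    change ((X : (IntegerRing k)[X]) : PowerRing k) ∣ _
    rw [coe_X, PowerSeries.X_dvd_iff, map_sub, OneUnit.constantCoeff, map_one, sub_self]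
  have h1 : normRoot (X : (IntegerRing k)[X]) (1 : PowerRing k) = 1 :=
    map_one (normRootHom (distX k))
  exact congrArg Subtype.val (h.trans h1)

variable (c : kˣ) (w : ℤ) {a : ℕ+ → IntegerRing k}
  (ha : ∀ i, a i ∈ IsLocalRing.maximalIdeal (IntegerRing k)) (u : OneUnit k) (S : Finset ℕ+)

/-- The distinguished polynomial `T^{max(w, 0)} ∏_{i ∈ S} (T^i - a_i)`. -/
def finiteNum : DistPoly k := distX k ^ w.toNat * ∏ i ∈ S, distXPowSub i (a i) (ha i)

variable (k) in
/-- The distinguished polynomial `T^{max(-w, 0)} ∏_{i ∈ S} T^i`. -/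
def finiteDen : DistPoly k := distX k ^ (-w).toNat * ∏ i ∈ S, distX k ^ (i : ℕ)

/-- The element `c T^w ∏_{i ∈ S} (1 - a_i T^{-i}) u` of `M`. -/
def finiteWitt : (FracField k)ˣ :=
  tripleToM k (c, finiteNum w ha S, u) / tripleToM k (1, finiteDen k w S, 1)

theorem natDegree_finiteNum :
    (finiteNum w ha S : (IntegerRing k)[X]).natDegree = w.toNat + ∑ i ∈ S, (i : ℕ) := by
  rw [finiteNum, Submonoid.coe_mul, SubmonoidClass.coe_pow, Submonoid.coe_finsetProd,
    Monic.natDegree_mul, Monic.natDegree_pow, natDegree_prod_of_monic]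
  · congr 1
    · change _ * (X : (IntegerRing k)[X]).natDegree = _
      rw [natDegree_X, mul_one]
    · exact Finset.sum_congr rfl fun i _ => natDegree_X_pow_sub_C
  · exact fun i _ => (distXPowSub i (a i) (ha i)).2.monic
  · exact (distX k).2.monic
  · exact (distX k).2.monic.pow _
  · exact monic_prod_of_monic _ _ fun i _ => (distXPowSub i (a i) (ha i)).2.monic

theorem natDegree_finiteDen :
    (finiteDen k w S : (IntegerRing k)[X]).natDegree = (-w).toNat + ∑ i ∈ S, (i : ℕ) := by
  rw [finiteDen, Submonoid.coe_mul, SubmonoidClass.coe_pow, Submonoid.coe_finsetProd,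
    Monic.natDegree_mul, Monic.natDegree_pow, natDegree_prod_of_monic]
  · congr 1
    · change _ * (X : (IntegerRing k)[X]).natDegree = _
      rw [natDegree_X, mul_one]
    · exact Finset.sum_congr rfl fun i _ => natDegree_X_pow _
  · exact fun i _ => (distX k ^ (i : ℕ)).2.monic
  · exact (distX k).2.monic
  · exact (distX k).2.monic.pow _
  · exact monic_prod_of_monic _ _ fun i _ => (distX k ^ (i : ℕ)).2.monic

theorem natDegree_finiteNum_sub_finiteDen :
    ((finiteNum w ha S : (IntegerRing k)[X]).natDegree -
      (finiteDen k w S : (IntegerRing k)[X]).natDegree : ℤ) = w := by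
  rw [natDegree_finiteNum, natDegree_finiteDen]
  push_cast
  omega

theorem normUnit_finiteNum (v : OneUnit k) :
    normUnit k (finiteNum w ha S) (v : (PowerRing k)ˣ) =
      ∏ i ∈ S, normUnit k (distXPowSub i (a i) (ha i)) (v : (PowerRing k)ˣ) := by
  rw [finiteNum, map_mul, map_pow, map_prod, MonoidHom.mul_apply, MonoidHom.pow_apply,
    normUnit_distX, one_pow, one_mul, MonoidHom.finsetProd_apply]

theorem normUnit_finiteDen (v : OneUnit k) :
    normUnit k (finiteDen k w S) (v : (PowerRing k)ˣ) = 1 := by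
  rw [finiteDen, map_mul, map_pow, map_prod, MonoidHom.mul_apply, MonoidHom.pow_apply,
    normUnit_distX, one_pow, one_mul, MonoidHom.finsetProd_apply]
  refine Finset.prod_eq_one fun i _ => ?_
  rw [map_pow, MonoidHom.pow_apply, normUnit_distX, one_pow]

theorem symM_finiteWitt (c' : kˣ) (w' : ℤ) {a' : ℕ+ → IntegerRing k}
    (ha' : ∀ i, a' i ∈ IsLocalRing.maximalIdeal (IntegerRing k)) (u' : OneUnit k)
    (S' : Finset ℕ+) :
    symM k (finiteWitt c w ha u S) (finiteWitt c' w' ha' u' S') =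
      (-1) ^ (w * w') * (c' ^ w / c ^ w') *
      ((∏ i ∈ S, normUnit k (distXPowSub i (a i) (ha i)) (u' : (PowerRing k)ˣ)) /
        ∏ i ∈ S', normUnit k (distXPowSub i (a' i) (ha' i)) (u : (PowerRing k)ˣ)) := by
  rw [finiteWitt, finiteWitt, symM_div_div, natDegree_finiteNum_sub_finiteDen,
    natDegree_finiteNum_sub_finiteDen, normUnit_finiteNum, normUnit_finiteNum, normUnit_finiteDen,
    normUnit_finiteDen, div_one, mul_one]

theorem coe_finiteWitt :
    (finiteWitt c w ha u S : FracField k) = constToM k c * powerToM k PowerSeries.X ^ w *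
      (∏ i ∈ S, (1 - constToM k (a i) * powerToM k PowerSeries.X ^ (-(i : ℤ)))) *
      powerToM k ((u : (PowerRing k)ˣ) : PowerRing k) := by
  have hX : powerToM k PowerSeries.X ≠ 0 :=
    (map_ne_zero_iff _ powerToM_injective).2 PowerSeries.X_ne_zero
  have hn : powerToM k ((finiteNum w ha S : (IntegerRing k)[X]) : PowerRing k) =
      powerToM k PowerSeries.X ^ w.toNat *
        ∏ i ∈ S, (powerToM k PowerSeries.X ^ (i : ℕ) - constToM k (a i)) := by
    simp only [finiteNum, Submonoid.coe_mul, SubmonoidClass.coe_pow, Submonoid.coe_finsetProd]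
    rw [← coeToPowerSeries.ringHom_apply, map_mul, map_mul, map_pow, map_pow, map_prod, map_prod]
    congr 1
    · exact congrArg (fun x => powerToM k x ^ w.toNat) coe_X
    · refine Finset.prod_congr rfl fun i _ => ?_
      change powerToM k ((X ^ (i : ℕ) - C (a i) : (IntegerRing k)[X]) : PowerRing k) = _
      rw [coe_sub, coe_pow, coe_X, coe_C, map_sub, map_pow, constToM_coe]
  have hd : powerToM k ((finiteDen k w S : (IntegerRing k)[X]) : PowerRing k) =
      powerToM k PowerSeries.X ^ (-w).toNat * ∏ i ∈ S, powerToM k PowerSeries.X ^ (i : ℕ) := by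
    simp only [finiteDen, Submonoid.coe_mul, SubmonoidClass.coe_pow, Submonoid.coe_finsetProd]
    rw [← coeToPowerSeries.ringHom_apply, map_mul, map_mul, map_pow, map_pow, map_prod, map_prod]
    congr 1
    · exact congrArg (fun x => powerToM k x ^ (-w).toNat) coe_X
    · refine Finset.prod_congr rfl fun i _ => ?_
      rw [map_pow, map_pow]
      exact congrArg (fun x => powerToM k x ^ (i : ℕ)) coe_X
  rw [finiteWitt, Units.val_div_eq_div_val, coe_tripleToM, coe_tripleToM, Triple.val, Triple.val]
  simp only [hn, hd, Units.val_one, map_one, OneMemClass.coe_one, one_mul, mul_one]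
  have h1 : ∏ i ∈ S, (1 - constToM k (a i) * powerToM k PowerSeries.X ^ (-(i : ℤ))) =
      (∏ i ∈ S, (powerToM k PowerSeries.X ^ (i : ℕ) - constToM k (a i))) /
        ∏ i ∈ S, powerToM k PowerSeries.X ^ (i : ℕ) := by
    rw [← Finset.prod_div_distrib]
    refine Finset.prod_congr rfl fun i _ => ?_
    rw [zpow_neg, zpow_natCast, sub_div, div_self (pow_ne_zero _ hX), div_eq_mul_inv]
  have h2 : powerToM k PowerSeries.X ^ w =
      powerToM k PowerSeries.X ^ w.toNat / powerToM k PowerSeries.X ^ (-w).toNat := by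
    rw [← zpow_natCast, ← zpow_natCast, ← zpow_sub₀ hX, Int.toNat_sub_toNat_neg]
  rw [h1, h2]
  field_simp

theorem valL_mul_sub_mul_le {A N N' B y : StdField k} (hy : valL k (N - N') < valL k (y * N')) :
    valL k (A * N * B - A * N' * B) ≤ valL k y * valL k (A * N' * B) := by
  have h : A * N * B - A * N' * B = A * B * (N - N') := by ring
  have h' : A * N' * B = A * B * N' := by ring
  rw [h, h', Valuation.map_mul, Valuation.map_mul _ (A * B) N', mul_left_comm,
    ← Valuation.map_mul _ y N']
  exact mul_le_mul_right hy.le _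

/-- The elements given by finite parts of the product `∏_{i ≥ 1} (1 - f_{-i} T^{-i})`
approximate `f`. -/
theorem WittData.Represents.exists_finiteWitt_div_mem {F : WittData k} {f : (StdField k)ˣ}
    {P : PowerRing k} (hP : PowerSeries.constantCoeff P = 1) {N : StdField k}
    (hN : HasProd (fun i : ℕ+ => 1 - mToL k (constToM k (F.neg i)) * paramT ^ (-(i : ℤ))) N)
    (hf : (f : StdField k) =
      mToL k (constToM k F.zero) * paramT ^ F.w * N * mToL k (powerToM k P)) (e : ℕ+) :
    ∃ S₀ : Finset ℕ+, ∀ S, S₀ ⊆ S →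
      unitsMToL k (finiteWitt F.zero F.w F.neg_mem (OneUnit.mk P hP) S) / f ∈ unitFilL k e := by
  classical
  have hf0 := f.ne_zero
  rw [hf] at hf0
  have hN0 := right_ne_zero_of_mul (left_ne_zero_of_mul hf0)
  rw [HasProd, SummationFilter.unconditional_filter] at hN
  -- The threshold π^e N is relative to the size of N, so multiplying by the other factors of f
  -- preserves the estimate.
  obtain ⟨S₀, hS₀⟩ := Filter.eventually_atTop.1 (hN.eventually (setOf_valL_sub_lt_mem_nhds N
    (y := unifL k ^ (e : ℕ) * N) (mul_ne_zero (pow_ne_zero _ isUnif_unifL.ne_zero) hN0)))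
  refine ⟨S₀, fun S hS => div_mem_unitFilL ?_⟩
  have h1 := valL_mul_sub_mul_le (A := mToL k (constToM k F.zero) * paramT ^ F.w)
    (B := mToL k (powerToM k P)) (hS₀ S hS)
  rw [Valuation.map_pow, valL_unifL, ← hf] at h1
  have h2 : ((unitsMToL k (finiteWitt F.zero F.w F.neg_mem (OneUnit.mk P hP) S) : (StdField k)ˣ) :
      StdField k) = mToL k (constToM k F.zero) * paramT ^ F.w *
        (∏ i ∈ S, (1 - mToL k (constToM k (F.neg i)) * paramT ^ (-(i : ℤ)))) *
        mToL k (powerToM k P) := by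
    change mToL k (finiteWitt F.zero F.w F.neg_mem (OneUnit.mk P hP) S : FracField k) = _
    rw [coe_finiteWitt, map_mul (mToL k), map_mul (mToL k), map_mul (mToL k), map_zpow₀ (mToL k),
      map_prod (mToL k)]
    simp only [map_sub (mToL k), map_mul (mToL k), map_zpow₀ (mToL k), map_one (mToL k)]
    rfl
  rw [h2]
  exact h1

end Approximation

/-! ### The product formula for the symbol -/

section Formula

variable {k : Type*} [NontriviallyNormedField k] [IsUltrametricDist k] [ProperSpace k]

theorem exists_finset_unif_pow_dvd (F : WittData k) (e : ℕ+) :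
    ∃ S₀ : Finset ℕ+, ∀ i ∉ S₀, unif k ^ (e : ℕ) ∣ F.neg i := by
  have h := F.neg_tendsto.norm
  rw [norm_zero] at h
  obtain ⟨n, hn⟩ := Filter.eventually_atTop.1
    (h.eventually_le_const (pow_pos (norm_unif_pos (k := k)) (e : ℕ)))
  refine ⟨Finset.Iic n, fun i hi => unif_pow_dvd_iff.2 (hn i ?_)⟩
  rw [Finset.mem_Iic, not_le] at hi
  exact hi.le

/-- The factor with index `(i, j)` of the product formula for the symbol. -/
def symbolFactor (F G : WittData k) (ij : ℕ+ × ℕ+) : kˣ :=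
  factorUnit (F.neg_mem ij.1) (G.pos ij.2) ij.1 ij.2 /
    factorUnit (G.neg_mem ij.2) (F.pos ij.1) ij.2 ij.1

/-- Dividing by the elementary part leaves only root products, so for each e it suffices to compare
finite products modulo U^e with the symbol of two truncations in M. -/
theorem hasProd_symbolFactor [CharZero k] {f g : (StdField k)ˣ} {F G : WittData k}
    (hF : F.Represents (f : StdField k)) (hG : G.Represents (g : StdField k)) :
    HasProd (fun ij : ℕ+ × ℕ+ => (symbolFactor F G ij : k))
      ((symbolL f g / ((-1) ^ (F.w * G.w) * (G.zero ^ F.w / F.zero ^ G.w)) : kˣ) : k) := by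
  classical
  obtain ⟨P, N, hP, hN, hf⟩ := hF
  obtain ⟨Q, R, hQ, hR, hg⟩ := hG
  refine hasProd_of_unitsMk fun e => ?_
  obtain ⟨S₁, hS₁⟩ := WittData.Represents.exists_finiteWitt_div_mem
    (constantCoeff_of_hasProd hP) hN hf e
  obtain ⟨S₂, hS₂⟩ := WittData.Represents.exists_finiteWitt_div_mem
    (constantCoeff_of_hasProd hQ) hR hg e
  obtain ⟨S₃, hS₃⟩ := exists_finset_unif_pow_dvd F e
  obtain ⟨S₄, hS₄⟩ := exists_finset_unif_pow_dvd G e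
  -- S₁ makes the truncation close to f, while S₃ contains every index whose negative parameter is
  -- not divisible by π^e; their union does both.
  obtain ⟨J, hJ⟩ := prod_unitsMk_factorUnit F.neg_mem hQ e (S := S₁ ∪ S₃)
    fun i hi => hS₃ i fun h => hi (Finset.mem_union_right _ h)
  obtain ⟨J', hJ'⟩ := prod_unitsMk_factorUnit G.neg_mem hP e (S := S₂ ∪ S₄)
    fun i hi => hS₄ i fun h => hi (Finset.mem_union_right _ h)
  -- In the denominators the negative parameter carries the second index, so the second rectangle is
  -- transposed.
  refine ⟨(S₁ ∪ S₃) ×ˢ J ∪ J' ×ˢ (S₂ ∪ S₄), fun s hs => ?_⟩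
  rw [map_div, unitsMk_symbolL, symLMod_eq (hS₁ _ Finset.subset_union_left)
    (hS₂ _ Finset.subset_union_left), symM_finiteWitt, ← map_div, mul_div_cancel_left, map_div,
    map_prod, map_prod, ← hJ s (Finset.subset_union_left.trans hs),
    ← hJ' (s.map (Equiv.prodComm _ _).toEmbedding) ?_, Finset.prod_map, ← Finset.prod_div_distrib]
  · exact Finset.prod_congr rfl fun ij _ => map_div _ _ _
  · rintro ⟨i, j⟩ hij
    rw [Finset.mem_product] at hij
    refine Finset.mem_map.2 ⟨(j, i), hs (Finset.mem_union_right _ ?_), rfl⟩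
    exact Finset.mem_product.2 ⟨hij.2, hij.1⟩

theorem coe_symbolFactor (F G : WittData k) (ij : ℕ+ × ℕ+) : (symbolFactor F G ij : k) =
    (1 - (F.neg ij.1 : k) ^ ((ij.2 : ℕ) / Nat.gcd ij.1 ij.2) *
      (G.pos ij.2 : k) ^ ((ij.1 : ℕ) / Nat.gcd ij.1 ij.2)) ^ Nat.gcd ij.1 ij.2 /
    (1 - (F.pos ij.1 : k) ^ ((ij.2 : ℕ) / Nat.gcd ij.1 ij.2) *
      (G.neg ij.2 : k) ^ ((ij.1 : ℕ) / Nat.gcd ij.1 ij.2)) ^ Nat.gcd ij.1 ij.2 := by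
  rw [symbolFactor, Units.val_div_eq_div_val, coe_factorUnit, coe_factorUnit,
    Nat.gcd_comm ij.2 ij.1,
    mul_comm ((G.neg ij.2 : k) ^ _)]

end Formula

end KatoSymbol
end

theorem mainTheorem8 (k : Type*) [NontriviallyNormedField k] [IsUltrametricDist k] [ProperSpace k]
    [CharZero k] :
    (∃! d : KatoSymbol.CompletedK2 (KatoSymbol.valL k) →+ Additive kˣ,
      KatoSymbol.IsInducedBoundary d) ∧
    ∀ (f g : (KatoSymbol.StdField k)ˣ) (F G : KatoSymbol.WittData k),
      F.Represents (f : KatoSymbol.StdField k) → G.Represents (g : KatoSymbol.StdField k) →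
      Multipliable (fun ij : ℕ+ × ℕ+ =>
        (1 - (F.neg ij.1 : k) ^ ((ij.2 : ℕ) / Nat.gcd ij.1 ij.2) *
            (G.pos ij.2 : k) ^ ((ij.1 : ℕ) / Nat.gcd ij.1 ij.2)) ^ Nat.gcd ij.1 ij.2 /
        (1 - (F.pos ij.1 : k) ^ ((ij.2 : ℕ) / Nat.gcd ij.1 ij.2) *
            (G.neg ij.2 : k) ^ ((ij.1 : ℕ) / Nat.gcd ij.1 ij.2)) ^ Nat.gcd ij.1 ij.2) ∧
      (KatoSymbol.symbolL f g : k) =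
        (-1) ^ (F.w * G.w) * ((G.zero : k) ^ F.w / (F.zero : k) ^ G.w) *
        ∏' ij : ℕ+ × ℕ+,
          (1 - (F.neg ij.1 : k) ^ ((ij.2 : ℕ) / Nat.gcd ij.1 ij.2) *
              (G.pos ij.2 : k) ^ ((ij.1 : ℕ) / Nat.gcd ij.1 ij.2)) ^ Nat.gcd ij.1 ij.2 /
          (1 - (F.pos ij.1 : k) ^ ((ij.2 : ℕ) / Nat.gcd ij.1 ij.2) *
              (G.neg ij.2 : k) ^ ((ij.1 : ℕ) / Nat.gcd ij.1 ij.2)) ^ Nat.gcd ij.1 ij.2 := by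
  refine ⟨KatoSymbol.existsUnique_isInducedBoundary, fun f g F G hF hG => ?_⟩
  have h := KatoSymbol.hasProd_symbolFactor hF hG
  simp only [KatoSymbol.coe_symbolFactor] at h
  refine ⟨h.multipliable, ?_⟩
  rw [h.tprod_eq, Units.val_div_eq_div_val]
  have hz : ((((-1) ^ (F.w * G.w) * (G.zero ^ F.w / F.zero ^ G.w) : kˣ)) : k) =
      (-1) ^ (F.w * G.w) * ((G.zero : k) ^ F.w / (F.zero : k) ^ G.w) := by
    push_cast
    rfl
  rw [← hz, mul_div_cancel₀ _ (Units.ne_zero _)]
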